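/- **Theorem (Complexity of empirical Bayesian networks).** Let $G$ be a directed acyclic graph on variables $X_1,\dots,X_n$ ($n\ge 1$) with finite non-empty domains $D_1,\dots,D_n$, and let $\mathcal D$ be a dataset of $t$ full assignments. The empirical Bayesian network $empBN(G,\mathcal D)$ has, for every $i$, the function $f_i$ with scope $S_i=\{X_i\}\cup PA_{X_i}$ and entries $f_i(x,pa)=\#\mathcal D(x,pa)/\#\mathcal D(pa)$, where $\#\mathcal D(s)$ is the number of samples consistent with $s$ (the entry is $0$ if $\#\mathcal D(pa)=0$). A tree-decomposition $\langle T,\chi,\psi\rangle$ is a finite tree $T$ with labels $\chi(v)\subseteq\{X_1,\dots,X_n\}$, $\psi(v)\subseteq\{f_1,\dots,f_n\}$ such that each $f_i$ lies in exactly one $\psi(v)$, $f_i\in\psi(v)$ implies $S_i\subseteq\chi(v)$, and for each variable the vertices $v$ with this variable in $\chi(v)$ induce a connected subgraph of $T$. Its width is $\max_v|\chi(v)|-1$. It is a hypertree decomposition if $\chi(v)\subseteq\bigcup_{f_i\in\psi(v)}S_i$ for all $v$; its hypertree width is then $\max_v|\psi(v)|$. Let $w$ be the least width of a tree-decomposition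 and $hw$ the least hypertree width of a hypertree decomposition (both depend on $G$ only). A sum-product query consists of evidence $e$ (values for an arbitrary set of variables) and a set $Q$ of query variables; the answer is the function $q\mapsto\sum_{x}\prod_i f_i(x)$ of the configurations $q$ of $Q$, where $x$ ranges over the full assignments consistent with $e$ and $q$. The answer is read off at a cluster of the decomposition, so $Q$ is any subset of a cluster $\chi(root)$; for example $Q=\emptyset$ (the answer is a number), or $Q\subseteq S_i$ for some $i$. (For arbitrary sets of variables, a probability $P(X=x\mid Y=y)$ is the quotient of the answers to the two queries with $Q=\emptyset$ and evidence $(x,y)$, $y$.) Cluster-tree elimination (CTE) sends one message per tree edge towards the root: $u$ sends the product of the functions in $\psi(u)$ and of the messages received from its other neighbours, restricted to $e$, summed out on $\chi(u)\cap\chi(v)$ for the receiving neighbour $v$; at the root it is summed out on $Q$, which is the answer. Messages are represented either as tables, or as relations (lists of tuples with their values) that are multiplied and summed out by sorting and merging. Time is the number of elementary operations (arithmetic operations, table accesses, and comparisons, projections and joins of tuples). Space is the largest number of table entries or tuples held at one time in the working memory, which is reused from cluster to cluster; a message is built in the working memory and leaves it when it has been sent. The input and a bounded number of registers are not counted. There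 is an absolute constant $C$ such that for all $n$ and $G$: 1. For every dataset $\mathcal D$ of $t$ samples, each empirical CPT $f_i$ has at most $t$ nonzero entries. 2. There is a tree-decomposition of width $w$ such that for every $k$, all domains with $1\le|D_i|\le k$, every dataset $\mathcal D$, every sum-product query $(Q,e)$ over $empBN(G,\mathcal D)$ and every root whose cluster contains $Q$, CTE with tables on this decomposition computes the answer in time at most $C\,n\,k^{w+1}$ and space at most $C\,k^{\max(w,|Q|)}$; in particular at most $C\,k^{w}$ if $|Q|\le w$. All messages and the answer together have at most $C\,n\,k^{\max(w,|Q|)}$ entries. 3. There is a hypertree decomposition of hypertree width $hw$ such that for all finite domains, every dataset $\mathcal D$ of $t\ge 2$ samples, every sum-product query $(Q,e)$ over $empBN(G,\mathcal D)$ and every root whose cluster contains $Q$, CTE with relations on this decomposition computes the answer in time at most $C\,n\cdot hw\cdot\log t\cdot t^{hw}$ and space at most $C\,t^{hw}$. All messages and the answer together have at most $C\,n\,t^{hw}$ entries. -/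

import Mathlib

namespace EmpBN

/-! ### Partial assignments -/

/-- A partial assignment of the variables `X_0, ..., X_{n-1}`, where `X_i` has the domain
`Fin (d i)`; `none` means that the variable is not assigned. A configuration of a set `S` of
variables is a partial assignment that assigns exactly the members of `S`. -/
abbrev Tuple {n : ℕ} (d : Fin n → ℕ) : Type := (i : Fin n) → Option (Fin (d i))

/-- A full assignment, read as a tuple. -/
def full {n : ℕ} {d : Fin n → ℕ} (x : (i : Fin n) → Fin (d i)) : Tuple d := fun i => some (x i)

/-- The projection of a tuple on a set of variables. -/
def restrict {n : ℕ} {d : Fin n → ℕ} (x : Tuple d) (S : Finset (Fin n)) : Tuple d :=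
  fun i => if i ∈ S then x i else none

/-- Two tuples are compatible if they agree on every variable that both assign. -/
def Compatible {n : ℕ} {d : Fin n → ℕ} (x y : Tuple d) : Prop :=
  ∀ i, x i = none ∨ y i = none ∨ x i = y i

instance {n : ℕ} {d : Fin n → ℕ} (x y : Tuple d) : Decidable (Compatible x y) := by
  unfold Compatible; infer_instance

/-- The join of two (compatible) tuples. -/
def union {n : ℕ} {d : Fin n → ℕ} (x y : Tuple d) : Tuple d := fun i => (x i).or (y i)

/-- The configurations of `S`. -/
def configs {n : ℕ} (d : Fin n → ℕ) (S : Finset (Fin n)) : Finset (Tuple d) :=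
  Finset.univ.filter fun x => ∀ i, (x i).isSome = true ↔ i ∈ S

/-- A code of a tuple by a list of numbers. Tuples are sorted by the lexicographic order of
their codes. -/
def code {n : ℕ} {d : Fin n → ℕ} (x : Tuple d) : List ℕ :=
  List.ofFn fun i => (x i).elim 0 fun a => a.val + 1

/-! ### Graphical models and empirical Bayesian networks -/

/-- A graphical model with the functions `f_0, ..., f_{r-1}`. The function `f_j` is read on
configurations of `scope j` only. -/
structure GraphicalModel {n : ℕ} (d : Fin n → ℕ) (r : ℕ) where
  scope : Fin r → Finset (Fin n)
  func : Fin r → Tuple d → ℚ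

/-- The value of the function `f_j` at a tuple that assigns at least its scope. -/
def GraphicalModel.value {n : ℕ} {d : Fin n → ℕ} {r : ℕ} (M : GraphicalModel d r) (j : Fin r)
    (x : Tuple d) : ℚ :=
  M.func j (restrict x (M.scope j))

/-- The configurations at which the function `f_j` does not vanish. -/
def GraphicalModel.support {n : ℕ} {d : Fin n → ℕ} {r : ℕ} (M : GraphicalModel d r) (j : Fin r) :
    Finset (Tuple d) :=
  (configs d (M.scope j)).filter fun x => M.func j x ≠ 0

/-- The tightness of the function `f_j`: the number of its nonzero entries. -/
def GraphicalModel.tightness {n : ℕ} {d : Fin n → ℕ} {r : ℕ} (M : GraphicalModel d r)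
    (j : Fin r) : ℕ :=
  (M.support j).card

/-- The relational specification of the function `f_j`: the list of its nonzero entries. -/
noncomputable def GraphicalModel.relation {n : ℕ} {d : Fin n → ℕ} {r : ℕ}
    (M : GraphicalModel d r) (j : Fin r) : List (Tuple d × ℚ) :=
  (M.support j).toList.map fun x => (x, M.func j x)

/-- The answer to a sum-product query with evidence `e`, at the configuration `q` of the query
variables: the sum of the product of all functions over all full assignments that extend both
`e` and `q`. -/
def GraphicalModel.sumProduct {n : ℕ} {d : Fin n → ℕ} {r : ℕ} (M : GraphicalModel d r)
    (e q : Tuple d) : ℚ :=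
  ∑ x : ((i : Fin n) → Fin (d i)),
    if Compatible (full x) e ∧ Compatible (full x) q then ∏ j, M.value j (full x) else 0

/-- A directed graph without directed cycles. -/
def IsAcyclic {n : ℕ} (G : Digraph (Fin n)) : Prop :=
  ∀ v, ¬ Relation.TransGen G.Adj v v

open Classical in
/-- The parents of a vertex of a directed graph. -/
noncomputable def parents {n : ℕ} (G : Digraph (Fin n)) (i : Fin n) : Finset (Fin n) :=
  Finset.univ.filter fun j => G.Adj j i

/-- A vertex together with its parents: the scope of its conditional probability table. -/
noncomputable def family {n : ℕ} (G : Digraph (Fin n)) (i : Fin n) : Finset (Fin n) :=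
  insert i (parents G i)

/-- The number of samples of the dataset `D` that are consistent with `s`. -/
def count {n t : ℕ} {d : Fin n → ℕ} (D : Fin t → (i : Fin n) → Fin (d i)) (s : Tuple d) : ℕ :=
  (Finset.univ.filter fun a => Compatible (full (D a)) s).card

/-- The empirical Bayesian network of a directed graph and a dataset of `t` samples. The entry
`P(x | pa)` is `#D(x, pa) / #D(pa)`; it is `0` if `pa` does not occur in the dataset. -/
noncomputable def empBN {n t : ℕ} {d : Fin n → ℕ} (G : Digraph (Fin n))
    (D : Fin t → (i : Fin n) → Fin (d i)) : GraphicalModel d n where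
  scope := family G
  func i s := (count D (restrict s (family G i)) : ℚ) / (count D (restrict s (parents G i)) : ℚ)

/-! ### Tree and hypertree decompositions -/

/-- A tree-decomposition of a graphical model whose functions have the scopes `scope j`. -/
structure TreeDecomposition {n r : ℕ} (scope : Fin r → Finset (Fin n)) where
  size : ℕ
  tree : SimpleGraph (Fin size)
  isTree : tree.IsTree
  χ : Fin size → Finset (Fin n)
  ψ : Fin size → Finset (Fin r)
  existsUnique_mem : ∀ j, ∃! v, j ∈ ψ v
  scope_subset : ∀ v, ∀ j ∈ ψ v, scope j ⊆ χ v
  connected : ∀ i, (tree.induce {v | i ∈ χ v}).Preconnected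

/-- The width of a tree-decomposition: the largest size of a cluster, minus one. -/
def TreeDecomposition.width {n r : ℕ} {scope : Fin r → Finset (Fin n)}
    (τ : TreeDecomposition scope) : ℕ :=
  (Finset.univ.sup fun v => (τ.χ v).card) - 1

/-- A tree-decomposition is a hypertree decomposition if every cluster is covered by the scopes
of the functions placed in it. -/
def TreeDecomposition.IsHypertree {n r : ℕ} {scope : Fin r → Finset (Fin n)}
    (τ : TreeDecomposition scope) : Prop :=
  ∀ v, τ.χ v ⊆ (τ.ψ v).biUnion scope

/-- The hypertree width of a hypertree decomposition: the largest number of functions placed in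
a cluster. -/
def TreeDecomposition.hyperwidth {n r : ℕ} {scope : Fin r → Finset (Fin n)}
    (τ : TreeDecomposition scope) : ℕ :=
  Finset.univ.sup fun v => (τ.ψ v).card

/-- The treewidth: the least width of a tree-decomposition. -/
noncomputable def treewidth {n r : ℕ} (scope : Fin r → Finset (Fin n)) : ℕ :=
  sInf {w | ∃ τ : TreeDecomposition scope, τ.width = w}

/-- The hypertree width: the least hypertree width of a hypertree decomposition. -/
noncomputable def hypertreewidth {n r : ℕ} (scope : Fin r → Finset (Fin n)) : ℕ :=
  sInf {w | ∃ τ : TreeDecomposition scope, τ.IsHypertree ∧ τ.hyperwidth = w}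

open Classical in
/-- The neighbours of `u` in the tree, other than the neighbour `p` to which `u` reports (there
is none if `u` is the root). -/
noncomputable def TreeDecomposition.children {n r : ℕ} {scope : Fin r → Finset (Fin n)}
    (τ : TreeDecomposition scope) (p : Option (Fin τ.size)) (u : Fin τ.size) :
    List (Fin τ.size) :=
  (List.finRange τ.size).filter fun c => τ.tree.Adj u c ∧ p ≠ some c

/-! ### Metered computations

The unit of time is one elementary operation: an arithmetic operation on numbers, an access to
one entry of a table, or a comparison, projection or join of two tuples. The unit of space is
one entry of a table (a number, or a tuple with its number). The input is not charged, nor is a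
bounded number of registers. -/

/-- The resources used so far. -/
structure Meter where
  /-- the number of elementary operations performed -/
  time : ℕ
  /-- the number of entries in the working memory now -/
  live : ℕ
  /-- the largest number of entries that were in the working memory at the same time -/
  peak : ℕ
  /-- the total number of entries of all messages sent, the answer included -/
  sent : ℕ

/-- Computations that keep account of their resources. -/
abbrev Metered (α : Type) : Type := StateM Meter α

/-- Perform `c` elementary operations. -/
def tick (c : ℕ) : Metered Unit := modify fun s => { s with time := s.time + c }

/-- Take `c` entries of working memory. -/
def alloc (c : ℕ) : Metered Unit :=
  modify fun s => { s with live := s.live + c, peak := max s.peak (s.live + c) }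

/-- Give back `c` entries of working memory. -/
def free (c : ℕ) : Metered Unit := modify fun s => { s with live := s.live - c }

/-- Hand over a message of `c` entries to the receiver; it leaves the working memory. -/
def emit (c : ℕ) : Metered Unit :=
  modify fun s => { s with live := s.live - c, sent := s.sent + c }

/-- Run a computation with empty working memory. -/
def runMetered {α : Type} (p : Metered α) : α × Meter := p.run ⟨0, 0, 0, 0⟩

/-! ### Cluster-tree elimination

Messages are sent from the leaves to the root. -/

/-- Message passing: `u` receives the message of each child `c`, which is a function on the
separator `χ u ∩ χ c`, and only then computes and sends its own message, a function on `sep`.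
The computation of one message is `send u sep msgs`. The first argument bounds the depth of the
recursion; the number of clusters is always enough. -/
noncomputable def collect {n r : ℕ} {scope : Fin r → Finset (Fin n)}
    (τ : TreeDecomposition scope) {β : Type}
    (send : Fin τ.size → Finset (Fin n) → List (Finset (Fin n) × β) → Metered β) :
    ℕ → Option (Fin τ.size) → Fin τ.size → Finset (Fin n) → Metered β
  | 0, _, u, sep => send u sep []
  | depth + 1, p, u, sep => do
      tick 1
      let msgs ← (τ.children p u).mapM fun c => do
        let m ← collect τ send depth (some u) c (τ.χ u ∩ τ.χ c)
        pure (τ.χ u ∩ τ.χ c, m)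
      send u sep msgs

/-! #### Tabular messages -/

/-- The number of entries of a table on `S`. -/
def cells {n : ℕ} (d : Fin n → ℕ) (S : Finset (Fin n)) : ℕ := ∏ i ∈ S, d i

/-- The message of the cluster `u` on `sep`, as a table: the product of the functions placed in
`u` and of the received messages, for all configurations of the cluster that are compatible
with the evidence, summed out on `sep`. The configurations are enumerated one by one, and the
product is not stored. -/
noncomputable def sendTable {n : ℕ} {d : Fin n → ℕ} {r : ℕ} (M : GraphicalModel d r)
    (τ : TreeDecomposition M.scope) (e : Tuple d) (u : Fin τ.size) (sep : Finset (Fin n))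
    (msgs : List (Finset (Fin n) × (Tuple d → ℚ))) : Metered (Tuple d → ℚ) := do
  alloc (cells d sep)
  tick (cells d sep)
  let table ← (configs d (τ.χ u)).toList.foldlM
    (fun table x => do
      tick 2
      if Compatible x e then do
        let p ← (τ.ψ u).toList.foldlM
          (fun p j => do tick 2; pure (p * M.value j x)) (1 : ℚ)
        let p ← msgs.foldlM
          (fun p m => do tick 3; pure (p * m.2 (restrict x m.1))) p
        tick 3
        let y := restrict x sep
        pure (Function.update table y (table y + p))
      else pure table)
    (fun _ => (0 : ℚ))
  emit (cells d sep)
  pure table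

/-- Cluster-tree elimination with tabular messages, for the query variables `Q` and the evidence
`e`, rooted at `root`. -/
noncomputable def cteTable {n : ℕ} {d : Fin n → ℕ} {r : ℕ} (M : GraphicalModel d r)
    (τ : TreeDecomposition M.scope) (e : Tuple d) (Q : Finset (Fin n)) (root : Fin τ.size) :
    Metered (Tuple d → ℚ) :=
  collect τ (sendTable M τ e) τ.size none root Q

/-! #### Relational messages -/

/-- The product of the relation `h` with a function specified by the relation `R`, restricted to
the tuples of `R` that are compatible with the evidence. The memory of `h` is given back. -/
def combine {n : ℕ} {d : Fin n → ℕ} (e : Tuple d) (h R : List (Tuple d × ℚ)) :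
    Metered (List (Tuple d × ℚ)) := do
  let out ← h.foldlM
    (fun acc p => do
      tick 1
      R.foldlM
        (fun acc q => do
          tick 3
          if Compatible p.1 q.1 ∧ Compatible q.1 e then do
            tick 2
            alloc 1
            pure ((union p.1 q.1, p.2 * q.2) :: acc)
          else pure acc)
        acc)
    []
  free h.length
  pure out

/-- Merge two relations that are sorted by their projections on `S`. The entries are relinked in
place. -/
def mergeSorted {n : ℕ} {d : Fin n → ℕ} (S : Finset (Fin n)) :
    List (Tuple d × ℚ) → List (Tuple d × ℚ) → Metered (List (Tuple d × ℚ))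
  | [], l => pure l
  | l, [] => pure l
  | p :: l, q :: l' => do
      tick 4
      if code (restrict p.1 S) ≤ code (restrict q.1 S) then do
        let m ← mergeSorted S l (q :: l')
        pure (p :: m)
      else do
        let m ← mergeSorted S (p :: l) l'
        pure (q :: m)
termination_by l l' => l.length + l'.length

/-- Merge sort of a relation by the projections of its tuples on `S`, with a given depth of the
recursion. The entries are relinked in place. -/
def sortDepth {n : ℕ} {d : Fin n → ℕ} (S : Finset (Fin n)) :
    ℕ → List (Tuple d × ℚ) → Metered (List (Tuple d × ℚ))
  | 0, l => pure l
  | depth + 1, l => do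
      tick l.length
      let a ← sortDepth S depth (l.take (l.length / 2))
      let b ← sortDepth S depth (l.drop (l.length / 2))
      mergeSorted S a b

/-- Merge sort of a relation by the projections of its tuples on `S`. -/
def sortOn {n : ℕ} {d : Fin n → ℕ} (S : Finset (Fin n)) (l : List (Tuple d × ℚ)) :
    Metered (List (Tuple d × ℚ)) := do
  tick (l.length + 1)
  sortDepth S (Nat.clog 2 l.length) l

/-- The product of the relation `h`, sorted by the projections on `S`, with a message on `S`
that is sorted and has at most one entry for every tuple. It replaces `h` in place; the
entries of `h` without a partner are given back. -/
def joinSorted {n : ℕ} {d : Fin n → ℕ} (S : Finset (Fin n)) :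
    List (Tuple d × ℚ) → List (Tuple d × ℚ) → Metered (List (Tuple d × ℚ))
  | [], _ => pure []
  | _ :: l, [] => do
      tick 1
      free 1
      joinSorted S l []
  | p :: l, q :: l' => do
      tick 3
      if restrict p.1 S = q.1 then do
        tick 2
        let m ← joinSorted S l (q :: l')
        pure ((p.1, p.2 * q.2) :: m)
      else if code (restrict p.1 S) < code q.1 then do
        free 1
        joinSorted S l (q :: l')
      else joinSorted S (p :: l) l'
termination_by l l' => l.length + l'.length

/-- Sum up runs of entries with the same projection on `S`; `(y, a)` is the current projection
and the sum of its run so far. -/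
def groupFrom {n : ℕ} {d : Fin n → ℕ} (S : Finset (Fin n)) (y : Tuple d) (a : ℚ) :
    List (Tuple d × ℚ) → Metered (List (Tuple d × ℚ))
  | [] => pure [(y, a)]
  | p :: l => do
      tick 4
      if restrict p.1 S = y then do
        free 1
        groupFrom S y (a + p.2) l
      else do
        let m ← groupFrom S (restrict p.1 S) p.2 l
        pure ((y, a) :: m)

/-- Sum out a relation on `S`: sort it by the projections on `S`, then add up every run of equal
projections, in place. -/
def sumOut {n : ℕ} {d : Fin n → ℕ} (S : Finset (Fin n)) (l : List (Tuple d × ℚ)) :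
    Metered (List (Tuple d × ℚ)) := do
  let h ← sortOn S l
  tick 1
  match h with
  | [] => pure []
  | p :: l => groupFrom S (restrict p.1 S) p.2 l

/-- The message of the cluster `u` on `sep`, as a sorted relation: combine the functions placed
in `u`, multiply by each of the received messages by sorting and merging, and sum out on
`sep`. -/
noncomputable def sendRelation {n : ℕ} {d : Fin n → ℕ} {r : ℕ} (M : GraphicalModel d r)
    (τ : TreeDecomposition M.scope) (e : Tuple d) (u : Fin τ.size) (sep : Finset (Fin n))
    (msgs : List (Finset (Fin n) × List (Tuple d × ℚ))) : Metered (List (Tuple d × ℚ)) := do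
  alloc 1
  let h ← (τ.ψ u).toList.foldlM (fun h j => combine e h (M.relation j))
    [((fun _ => none : Tuple d), (1 : ℚ))]
  let h ← msgs.foldlM
    (fun h m => do
      let h' ← sortOn m.1 h
      joinSorted m.1 h' m.2)
    h
  let out ← sumOut sep h
  emit out.length
  pure out

/-- Cluster-tree elimination with relational messages, for the query variables `Q` and the
evidence `e`, rooted at `root`. -/
noncomputable def cteRelation {n : ℕ} {d : Fin n → ℕ} {r : ℕ} (M : GraphicalModel d r)
    (τ : TreeDecomposition M.scope) (e : Tuple d) (Q : Finset (Fin n)) (root : Fin τ.size) :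
    Metered (List (Tuple d × ℚ)) :=
  collect τ (sendRelation M τ e) τ.size none root Q

/-- The value at `q` of the function specified by a relation. -/
def lookup {n : ℕ} {d : Fin n → ℕ} (R : List (Tuple d × ℚ)) (q : Tuple d) : ℚ :=
  ((R.filter fun p => p.1 = q).map Prod.snd).sum

end EmpBN

/-! Correctness rests on one identity. The message that a cluster `u` sends over a tree edge is the
product of all factors on its side of the edge, summed over the variables of that side outside the
separator. By connectedness, the variables that the subtrees below `u` contain outside `χ u` are
pairwise disjoint, so distributivity moves each sum into its own subtree (`marg_prod`,
`TreeDecomposition.marg_message`). At the root the side is the whole tree and the identity gives the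
answer.

Resources are tracked by `Spec`, a Hoare-style triple with a frame `L` for memory owned elsewhere.
`collect_spec` carries out the induction over the rooted tree once for both representations: time
and traffic add up over the clusters, while the peak is a maximum because a message leaves the
working memory when it is sent. It remains to have few clusters and cheap ones.

Few clusters: an edge with `χ u ⊆ χ v` can be contracted without raising the width, so a smallest
decomposition of least width has no such edge. Then every cluster has a variable that its parent
lacks, which gives at most `n` clusters, and every separator is a proper subset of a cluster, which
gives space exponent `w` beside time exponent `w + 1`. In a hypertree decomposition a cluster
without functions is empty and can be contracted away; as each function lies in one cluster, at most
`n` clusters remain.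

Cheap clusters: with tables, at most `k ^ (w + 1)` configurations are streamed, at constant cost per
function and per message. With relations, a nonzero entry of an empirical table is the projection of
a sample (`tightness_empBN_le`), so a cluster joins at most `hw` relations of at most `t` tuples.
The covering condition makes the join assign the whole cluster; multiplying by messages and summing
out can then only shrink it, so nothing kept between these steps exceeds `t ^ hw` tuples, and
sorting costs the further factor `hw * log t`. -/

namespace EmpBN

open Finset

/-! ### Branches of a tree at a vertex. -/

section Trees

variable {V : Type*} {T : SimpleGraph V}

/-- Shortening the walk to a path makes its tail avoid the start. -/
theorem exists_first_step {u v : V} (w : T.Walk u v) (h : u ≠ v) :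
    ∃ c, T.Adj u c ∧ ∃ w' : T.Walk c v, w'.support ⊆ w.support ∧ u ∉ w'.support := by
  classical
  have hs := w.support_bypass_subset_support
  have hp := w.bypass_isPath
  revert hs hp
  cases w.bypass with
  | nil => exact absurd rfl h
  | cons hadj q =>
    intro hs hp
    rw [SimpleGraph.Walk.cons_isPath_iff] at hp
    exact ⟨_, hadj, q, fun x hx => hs (by simp [hx]), hp.2⟩

/-- Otherwise `a, u, b` is the only path from `a` to `b`, and the path extracted from the walk would
pass through `u`. -/
theorem eq_of_walk_avoiding (hT : T.IsAcyclic) {u a b : V} (ha : T.Adj u a) (hb : T.Adj u b)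
    (w : T.Walk a b) (hw : u ∉ w.support) : a = b := by
  classical
  by_contra hab
  have h2 : (SimpleGraph.Walk.cons ha.symm (SimpleGraph.Walk.cons hb .nil)).IsPath := by
    simp [SimpleGraph.Walk.cons_isPath_iff, hab, ha.ne', hb.ne]
  have := (hT.subsingleton_path a b).elim ⟨w.bypass, w.bypass_isPath⟩ ⟨_, h2⟩
  have h3 : w.bypass = _ := congrArg Subtype.val this
  apply hw
  apply w.support_bypass_subset_support
  rw [h3]
  simp

variable [Fintype V]

open Classical in
/-- The vertices that can be reached from `u` without meeting `p`. -/
noncomputable def side (T : SimpleGraph V) (p : Option V) (u : V) : Finset V :=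
  univ.filter fun v => ∃ w : T.Walk u v, ∀ x ∈ w.support, p ≠ some x

theorem mem_side {p : Option V} {u v : V} :
    v ∈ side T p u ↔ ∃ w : T.Walk u v, ∀ x ∈ w.support, p ≠ some x := by
  simp [side]

theorem mem_side_some {p u v : V} :
    v ∈ side T (some p) u ↔ ∃ w : T.Walk u v, p ∉ w.support := by
  rw [mem_side]
  refine exists_congr fun w => ⟨fun h hp => h p hp rfl, ?_⟩
  rintro h x hx ⟨⟩
  exact h hx

theorem side_none (hT : T.Connected) (u : V) : side T none u = univ := by
  ext v
  obtain ⟨w⟩ := hT.preconnected u v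
  simp only [mem_side, mem_univ, iff_true]
  exact ⟨w, by simp⟩

theorem self_mem_side {p : Option V} {u : V} (h : p ≠ some u) : u ∈ side T p u :=
  mem_side.2 ⟨.nil, by simpa using h⟩

theorem not_mem_side_some {p u : V} : p ∉ side T (some p) u := by
  rw [mem_side_some]
  rintro ⟨w, hw⟩
  exact hw w.end_mem_support

/-- If a walk from `c` that avoids `u` met `p`, it would join two neighbours of `u` away from `u`,
forcing `p = c`. -/
theorem side_subset_side (hT : T.IsAcyclic) {p : Option V} {u c : V}
    (hp : ∀ q, p = some q → T.Adj u q) (hc : T.Adj u c) (hpc : p ≠ some c) : side T (some u) c ⊆ side T p u := by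
  classical
  intro v hv
  obtain ⟨w, hw⟩ := mem_side_some.1 hv
  refine mem_side.2 ⟨.cons hc w, ?_⟩
  rintro x hx rfl
  have hux : T.Adj u x := hp x rfl
  simp only [SimpleGraph.Walk.support_cons, List.mem_cons] at hx
  rcases hx with rfl | hx
  · exact hux.ne rfl
  · refine hpc (congrArg some (eq_of_walk_avoiding hT hux hc (w.takeUntil x hx).reverse ?_))
    rw [SimpleGraph.Walk.support_reverse, List.mem_reverse]
    exact fun h => hw (w.support_takeUntil_subset_support hx h)

theorem eq_of_mem_side (hT : T.IsAcyclic) {u c c' v : V} (hc : T.Adj u c) (hc' : T.Adj u c')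
    (h : v ∈ side T (some u) c) (h' : v ∈ side T (some u) c') : c = c' := by
  obtain ⟨w, hw⟩ := mem_side_some.1 h
  obtain ⟨w', hw'⟩ := mem_side_some.1 h'
  refine eq_of_walk_avoiding hT hc hc' (w.append w'.reverse) ?_
  rw [SimpleGraph.Walk.mem_support_append_iff, SimpleGraph.Walk.support_reverse, List.mem_reverse]
  tauto

theorem exists_child_of_mem_side {p : Option V} {u v : V} (h : v ∈ side T p u) (huv : u ≠ v) :
    ∃ c, T.Adj u c ∧ p ≠ some c ∧ v ∈ side T (some u) c := by
  obtain ⟨w, hw⟩ := mem_side.1 h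
  obtain ⟨c, hc, w', hs, hu⟩ := exists_first_step w huv
  exact ⟨c, hc, hw c (hs w'.start_mem_support), mem_side_some.2 ⟨w', hu⟩⟩

end Trees

/-! ### Running intersection and the number of clusters. -/

section Decompositions

variable {n r : ℕ} {scope : Fin r → Finset (Fin n)} (τ : TreeDecomposition scope)

theorem TreeDecomposition.exists_walk {i : Fin n} {u v : Fin τ.size} (hu : i ∈ τ.χ u)
    (hv : i ∈ τ.χ v) : ∃ w : τ.tree.Walk u v, ∀ x ∈ w.support, i ∈ τ.χ x := by
  have key : ∀ {a b : {v | i ∈ τ.χ v}} (_ : (τ.tree.induce {v | i ∈ τ.χ v}).Walk a b),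
      ∃ w : τ.tree.Walk a.1 b.1, ∀ x ∈ w.support, i ∈ τ.χ x := by
    intro a b w
    induction w with
    | @nil a => 
      refine ⟨.nil, fun x hx => ?_⟩
      rw [SimpleGraph.Walk.support_nil, List.mem_singleton] at hx
      exact hx ▸ a.2
    | @cons a c b h w ih =>
      obtain ⟨w', hw'⟩ := ih
      have h : τ.tree.Adj a.1 c.1 := h
      refine ⟨.cons h w', ?_⟩
      rw [SimpleGraph.Walk.support_cons, List.forall_mem_cons]
      exact ⟨a.2, hw'⟩
  obtain ⟨w⟩ := τ.connected i ⟨u, hu⟩ ⟨v, hv⟩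
  exact key w

/-- The variables of the clusters on one side of an edge. -/
noncomputable def TreeDecomposition.vars (p : Option (Fin τ.size)) (u : Fin τ.size) :
    Finset (Fin n) :=
  (side τ.tree p u).biUnion τ.χ

/-- The clusters that contain `i` are connected, and the far side is reached from `u` only through
`c`. -/
theorem TreeDecomposition.mem_of_mem_vars {i : Fin n} {u c : Fin τ.size} (hc : τ.tree.Adj u c)
    (hi : i ∈ τ.vars (some u) c) (hu : i ∈ τ.χ u) : i ∈ τ.χ c := by
  obtain ⟨v, hv, hiv⟩ := mem_biUnion.1 hi
  have huv : u ≠ v := by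
    rintro rfl
    exact not_mem_side_some hv
  obtain ⟨w, hw⟩ := τ.exists_walk hu hiv
  obtain ⟨c', hc', w', hs, hu'⟩ := exists_first_step w huv
  have := eq_of_mem_side τ.isTree.isAcyclic hc hc' hv (mem_side_some.2 ⟨w', hu'⟩)
  subst this
  exact hw _ (hs w'.start_mem_support)

theorem TreeDecomposition.mem_of_mem_vars_of_mem_vars {i : Fin n} {u c c' : Fin τ.size}
    (hc : τ.tree.Adj u c) (hc' : τ.tree.Adj u c') (hne : c ≠ c')
    (hi : i ∈ τ.vars (some u) c) (hi' : i ∈ τ.vars (some u) c') : i ∈ τ.χ u := by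
  obtain ⟨v, hv, hiv⟩ := mem_biUnion.1 hi
  obtain ⟨v', hv', hiv'⟩ := mem_biUnion.1 hi'
  obtain ⟨w, hw⟩ := τ.exists_walk hiv hiv'
  by_contra hu
  obtain ⟨a, ha⟩ := mem_side_some.1 hv
  obtain ⟨b, hb⟩ := mem_side_some.1 hv'
  -- If `i` were missing from `χ u`, the walk `c, v, v', c'` would avoid `u` and identify the two
  -- branches.
  refine hne (eq_of_walk_avoiding τ.isTree.isAcyclic hc hc' ((a.append w).append b.reverse) ?_)
  simp only [SimpleGraph.Walk.mem_support_append_iff, SimpleGraph.Walk.support_reverse,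
    List.mem_reverse]
  rintro ((h | h) | h)
  · exact ha h
  · exact hu (hw _ h)
  · exact hb h

/-- The children of a cluster, as a finite set. -/
noncomputable def TreeDecomposition.childSet (p : Option (Fin τ.size)) (u : Fin τ.size) :
    Finset (Fin τ.size) :=
  (τ.children p u).toFinset

theorem TreeDecomposition.mem_children {p : Option (Fin τ.size)} {u c : Fin τ.size} :
    c ∈ τ.children p u ↔ τ.tree.Adj u c ∧ p ≠ some c := by
  simp [children]

theorem TreeDecomposition.mem_childSet {p : Option (Fin τ.size)} {u c : Fin τ.size} :
    c ∈ τ.childSet p u ↔ τ.tree.Adj u c ∧ p ≠ some c := by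
  simp [childSet, mem_children]

theorem TreeDecomposition.nodup_children (p : Option (Fin τ.size)) (u : Fin τ.size) :
    (τ.children p u).Nodup :=
  (List.nodup_finRange _).filter _

theorem TreeDecomposition.ne_some_of_adj {p : Option (Fin τ.size)} {u : Fin τ.size}
    (hp : ∀ q, p = some q → τ.tree.Adj u q) : p ≠ some u :=
  fun h => (hp u h).ne rfl

theorem TreeDecomposition.side_eq {p : Option (Fin τ.size)} {u : Fin τ.size}
    (hp : ∀ q, p = some q → τ.tree.Adj u q) :
    side τ.tree p u = insert u ((τ.childSet p u).biUnion fun c => side τ.tree (some u) c) := by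
  ext v
  simp only [mem_insert, mem_biUnion, mem_childSet]
  constructor
  · intro h
    rcases eq_or_ne u v with rfl | huv
    · exact Or.inl rfl
    · obtain ⟨c, h1, h2, h3⟩ := exists_child_of_mem_side h huv
      exact Or.inr ⟨c, ⟨h1, h2⟩, h3⟩
  · rintro (rfl | ⟨c, ⟨h1, h2⟩, h3⟩)
    · exact self_mem_side (τ.ne_some_of_adj hp)
    · exact side_subset_side τ.isTree.isAcyclic hp h1 h2 h3

theorem TreeDecomposition.not_mem_biUnion_side {p : Option (Fin τ.size)} {u : Fin τ.size} :
    u ∉ (τ.childSet p u).biUnion fun c => side τ.tree (some u) c := by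
  simp only [mem_biUnion, not_exists, not_and]
  exact fun c _ => not_mem_side_some

theorem TreeDecomposition.pairwiseDisjoint_side (p : Option (Fin τ.size)) (u : Fin τ.size) :
    (τ.childSet p u : Set (Fin τ.size)).PairwiseDisjoint fun c => side τ.tree (some u) c := by
  intro c hc c' hc' hne
  rw [Function.onFun, Finset.disjoint_left]
  intro v hv hv'
  exact hne (eq_of_mem_side τ.isTree.isAcyclic (τ.mem_childSet.1 hc).1 (τ.mem_childSet.1 hc').1
    hv hv')

theorem TreeDecomposition.prod_side {M : Type*} [CommMonoid M] {p : Option (Fin τ.size)}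
    {u : Fin τ.size} (hp : ∀ q, p = some q → τ.tree.Adj u q) (f : Fin τ.size → M) :
    ∏ v ∈ side τ.tree p u, f v = f u * ∏ c ∈ τ.childSet p u, ∏ v ∈ side τ.tree (some u) c, f v := by
  rw [τ.side_eq hp, prod_insert τ.not_mem_biUnion_side,
    prod_biUnion (τ.pairwiseDisjoint_side p u)]

theorem TreeDecomposition.sum_side {M : Type*} [AddCommMonoid M] {p : Option (Fin τ.size)}
    {u : Fin τ.size} (hp : ∀ q, p = some q → τ.tree.Adj u q) (f : Fin τ.size → M) :
    ∑ v ∈ side τ.tree p u, f v = f u + ∑ c ∈ τ.childSet p u, ∑ v ∈ side τ.tree (some u) c, f v := by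
  rw [τ.side_eq hp, sum_insert τ.not_mem_biUnion_side,
    sum_biUnion (τ.pairwiseDisjoint_side p u)]

theorem TreeDecomposition.card_side {p : Option (Fin τ.size)}
    {u : Fin τ.size} (hp : ∀ q, p = some q → τ.tree.Adj u q) :
    #(side τ.tree p u) = 1 + ∑ c ∈ τ.childSet p u, #(side τ.tree (some u) c) := by
  simpa only [card_eq_sum_ones] using τ.sum_side hp fun _ => 1

theorem TreeDecomposition.vars_eq {p : Option (Fin τ.size)} {u : Fin τ.size}
    (hp : ∀ q, p = some q → τ.tree.Adj u q) :
    τ.vars p u = τ.χ u ∪ (τ.childSet p u).biUnion fun c => τ.vars (some u) c := by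
  rw [vars, τ.side_eq hp, biUnion_insert, biUnion_biUnion]
  rfl

theorem TreeDecomposition.adj_of_mem_childSet {p : Option (Fin τ.size)} {u c : Fin τ.size}
    (hc : c ∈ τ.childSet p u) : ∀ q, some u = some q → τ.tree.Adj c q := by
  rintro q ⟨⟩
  exact (τ.mem_childSet.1 hc).1.symm

/-- Induction over a rooted tree, from the leaves to the root. -/
theorem TreeDecomposition.side_induction
    {P : Option (Fin τ.size) → Fin τ.size → Prop}
    (h : ∀ p u, (∀ q, p = some q → τ.tree.Adj u q) →
      (∀ c ∈ τ.childSet p u, P (some u) c) → P p u)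
    (p : Option (Fin τ.size)) (u : Fin τ.size) (hp : ∀ q, p = some q → τ.tree.Adj u q) :
    P p u := by
  induction hN : #(side τ.tree p u) using Nat.strong_induction_on generalizing p u with
  | _ N ih =>
    refine h p u hp fun c hc => ih _ ?_ _ _ (τ.adj_of_mem_childSet hc) rfl
    have := single_le_sum (f := fun c => #(side τ.tree (some u) c)) (fun _ _ => Nat.zero_le _) hc
    rw [← hN, τ.card_side hp]
    omega

theorem TreeDecomposition.pairwiseDisjoint_vars_sdiff (p : Option (Fin τ.size)) (u : Fin τ.size) :
    (τ.childSet p u : Set (Fin τ.size)).PairwiseDisjoint fun c => τ.vars (some u) c \ τ.χ u := by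
  intro c hc c' hc' hne
  rw [Function.onFun, Finset.disjoint_left]
  intro i hi hi'
  rw [mem_sdiff] at hi hi'
  exact hi.2 (τ.mem_of_mem_vars_of_mem_vars (τ.mem_childSet.1 hc).1 (τ.mem_childSet.1 hc').1 hne
    hi.1 hi'.1)

/-- Each cluster contributes a variable that its parent lacks, and connectedness keeps these
contributions distinct. `S` stands for the parent's cluster and is `∅` at the root. The disjointness
hypothesis says that the variables of `S` met below `u` already lie in `χ u`. -/
theorem TreeDecomposition.card_side_le
    (hred : ∀ u v, τ.tree.Adj u v → ¬ τ.χ u ⊆ τ.χ v)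
    (p : Option (Fin τ.size)) (u : Fin τ.size) (hp : ∀ q, p = some q → τ.tree.Adj u q) :
    ∀ S : Finset (Fin n), ¬ τ.χ u ⊆ S →
      (∀ c ∈ τ.childSet p u, Disjoint (τ.vars (some u) c \ τ.χ u) S) →
      #(side τ.tree p u) ≤ #(τ.vars p u \ S) := by
  refine τ.side_induction (P := fun p u => ∀ S : Finset (Fin n), ¬ τ.χ u ⊆ S →
      (∀ c ∈ τ.childSet p u, Disjoint (τ.vars (some u) c \ τ.χ u) S) →
      #(side τ.tree p u) ≤ #(τ.vars p u \ S)) ?_ p u hp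
  intro p u hp ih S hS hdis
  have hsub : (τ.χ u \ S) ∪ ((τ.childSet p u).biUnion fun c => τ.vars (some u) c \ τ.χ u)
      ⊆ τ.vars p u \ S := by
    rw [τ.vars_eq hp]
    intro i hi
    simp only [mem_union, mem_sdiff, mem_biUnion] at hi ⊢
    rcases hi with hi | ⟨c, hc, hi⟩
    · exact ⟨Or.inl hi.1, hi.2⟩
    · exact ⟨Or.inr ⟨c, hc, hi.1⟩, disjoint_left.1 (hdis c hc) (mem_sdiff.2 hi)⟩
  refine le_trans ?_ (card_le_card hsub)
  rw [card_union_of_disjoint, card_biUnion (τ.pairwiseDisjoint_vars_sdiff p u), τ.card_side hp]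
  · refine Nat.add_le_add ?_ (sum_le_sum fun c hc => ?_)
    · rw [Nat.one_le_iff_ne_zero, Ne, card_eq_zero, sdiff_eq_empty_iff_subset]
      exact hS
    -- The child is treated with `S := χ u`. A variable of `χ u` that occurs below `c` lies in `χ
    -- c`, which gives the disjointness.
    · refine ih c hc _ (hred _ _ (τ.mem_childSet.1 hc).1.symm) ?_
      intro c' hc'
      rw [Finset.disjoint_left]
      intro i hi hiu
      rw [mem_sdiff] at hi
      refine hi.2 (τ.mem_of_mem_vars (τ.mem_childSet.1 hc).1 ?_ hiu)
      rw [τ.vars_eq (τ.adj_of_mem_childSet hc), mem_union, mem_biUnion]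
      exact Or.inr ⟨c', hc', hi.1⟩
  · rw [Finset.disjoint_left]
    intro i hi hi'
    simp only [mem_sdiff, mem_biUnion] at hi hi'
    obtain ⟨c, -, h⟩ := hi'
    exact h.2 hi.1

/-- A decomposition without redundant clusters has at most as many clusters as variables. -/
theorem TreeDecomposition.size_le_of_reduced
    (hred : ∀ u v, τ.tree.Adj u v → ¬ τ.χ u ⊆ τ.χ v) (root : Fin τ.size)
    (hroot : (τ.χ root).Nonempty) : τ.size ≤ n := by
  have h := τ.card_side_le hred none root (by simp) ∅
    (by rw [subset_empty]; exact hroot.ne_empty) (by simp)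
  rw [side_none τ.isTree.connected, card_univ, Fintype.card_fin] at h
  exact h.trans ((card_le_univ _).trans (by simp))

end Decompositions

/-! ### Edge contraction and decompositions of minimal size. -/

section Contraction

/-- Edges may collapse to points, so this applies to contractions, which are not graph
homomorphisms. -/
theorem reachable_map {V W : Type*} {G : SimpleGraph V} {H : SimpleGraph W} (f : V → W)
    (hf : ∀ a b, G.Adj a b → f a = f b ∨ H.Adj (f a) (f b)) {a b : V} (h : G.Reachable a b) :
    H.Reachable (f a) (f b) := by
  obtain ⟨w⟩ := h
  induction w with
  | nil => exact .refl _
  | cons hadj _ ih =>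
    rcases hf _ _ hadj with h | h
    · rwa [h]
    · exact h.reachable.trans ih

/-- The map that contracts `u` into another vertex `v`. -/
def contract {V : Type*} [DecidableEq V] (u v : V) (h : v ≠ u) (x : V) : {x // x ≠ u} :=
  if hx : x = u then ⟨v, h⟩ else ⟨x, hx⟩

theorem contract_of_ne {V : Type*} [DecidableEq V] {u v : V} {h : v ≠ u} (x : {x // x ≠ u}) :
    contract u v h x.1 = x := by
  simp [contract, x.2]

/-- The image of a connected graph is connected. The edge `uv` collapses, so at least one edge is
lost together with one vertex, and a connected graph with so few edges is a tree. -/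
theorem isTree_map_contract {V : Type*} [Fintype V] [DecidableEq V] {T : SimpleGraph V}
    (hT : T.IsTree) {u v : V} (h : v ≠ u) (huv : T.Adj u v) : (T.map (contract u v h)).IsTree := by
  rw [SimpleGraph.isTree_iff_connected_and_card] at hT ⊢
  have hconn : (T.map (contract u v h)).Connected := by
    refine { preconnected := fun a b => ?_, nonempty := ⟨⟨v, h⟩⟩ }
    rw [← contract_of_ne (h := h) a, ← contract_of_ne (h := h) b]
    refine reachable_map _ (fun x y hxy => ?_) (hT.1.preconnected a.1 b.1)
    rw [SimpleGraph.map_adj']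
    by_cases hc : contract u v h x = contract u v h y
    · exact Or.inl hc
    · exact Or.inr ⟨hc, x, y, hxy, rfl, rfl⟩
  refine ⟨hconn, le_antisymm ?_ hconn.card_vert_le_card_edgeSet_add_one⟩
  have hsub : (T.map (contract u v h)).edgeSet ⊆
      Sym2.map (contract u v h) '' (T.edgeSet \ {s(u, v)}) := by
    intro e he
    induction e with
    | _ a b =>
      rw [SimpleGraph.mem_edgeSet, SimpleGraph.map_adj'] at he
      obtain ⟨hne, x, y, hxy, rfl, rfl⟩ := he
      refine ⟨s(x, y), ⟨hxy, ?_⟩, rfl⟩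
      rintro hs
      rw [Set.mem_singleton_iff, Sym2.eq_iff] at hs
      apply hne
      rcases hs with ⟨rfl, rfl⟩ | ⟨rfl, rfl⟩ <;> simp [contract, h]
  have h1 := (Set.ncard_le_ncard hsub (Set.toFinite _)).trans (Set.ncard_image_le (Set.toFinite _))
  have h2 := Set.ncard_sdiff_singleton_add_one (s := T.edgeSet) (a := s(u, v)) huv (Set.toFinite _)
  have h3 : Nat.card {x // x ≠ u} + 1 = Nat.card V := by
    rw [Nat.card_eq_fintype_card, Nat.card_eq_fintype_card, Fintype.card_subtype_compl,
      Fintype.card_subtype_eq]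
    have := Fintype.card_pos_iff.2 ⟨u⟩
    omega
  have h4 := hT.2
  rw [Nat.card_coe_set_eq] at h4 ⊢
  omega

variable {n r : ℕ} {scope : Fin r → Finset (Fin n)}

/-- A tree-decomposition on an arbitrary finite tree. -/
theorem exists_treeDecomposition_equiv {V : Type*} [Fintype V] {T : SimpleGraph V} (hT : T.IsTree)
    (χ : V → Finset (Fin n)) (ψ : V → Finset (Fin r)) (h1 : ∀ j, ∃! v, j ∈ ψ v)
    (h2 : ∀ v, ∀ j ∈ ψ v, scope j ⊆ χ v)
    (h3 : ∀ i, (T.induce {v | i ∈ χ v}).Preconnected) :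
    ∃ (τ : TreeDecomposition scope) (f : Fin τ.size ≃ V), τ.size = Fintype.card V ∧
      (∀ v, τ.χ v = χ (f v)) ∧ ∀ v, τ.ψ v = ψ (f v) := by
  let f : Fin (Fintype.card V) ≃ V := (Fintype.equivFin V).symm
  refine ⟨⟨Fintype.card V, T.comap f, ?_, fun v => χ (f v), fun v => ψ (f v), ?_,
    fun v => h2 (f v), ?_⟩, f, rfl, fun _ => rfl, fun _ => rfl⟩
  · exact (SimpleGraph.Iso.isTree_iff (SimpleGraph.Iso.comap f T)).2 hT
  · intro j
    obtain ⟨v, hv, huniq⟩ := h1 j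
    refine ⟨f.symm v, by simpa using hv, fun y hy => ?_⟩
    rw [Equiv.eq_symm_apply]
    exact huniq _ hy
  · rintro i ⟨a, ha⟩ ⟨b, hb⟩
    have := reachable_map (H := (T.comap f).induce {v | i ∈ χ (f v)})
      (fun x : {v | i ∈ χ v} => ⟨f.symm x.1, (congrArg (i ∈ χ ·) (f.apply_symm_apply x.1)).mpr x.2⟩)
      (fun x y hxy => Or.inr (by simpa using hxy)) (h3 i ⟨f a, ha⟩ ⟨f b, hb⟩)
    simpa using this

/-- Contraction of an edge whose end `u` has a redundant cluster. -/
theorem TreeDecomposition.exists_contraction (τ : TreeDecomposition scope) {u v : Fin τ.size}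
    (huv : τ.tree.Adj u v) (hsub : τ.χ u ⊆ τ.χ v) :
    ∃ (σ : TreeDecomposition scope) (f : Fin σ.size → Fin τ.size), σ.size < τ.size ∧
      (∀ x, σ.χ x = τ.χ (f x)) ∧
      ∀ x, σ.ψ x = if f x = v then τ.ψ u ∪ τ.ψ v else τ.ψ (f x) := by
  have h : v ≠ u := huv.ne'
  have h1 : ∀ j, ∃! x : {x // x ≠ u}, j ∈ if x.1 = v then τ.ψ u ∪ τ.ψ v else τ.ψ x.1 := by
    intro j
    obtain ⟨w, hw, huniq⟩ := τ.existsUnique_mem j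
    refine ⟨contract u v h w, ?_, ?_⟩
    · by_cases hwu : w = u
      · subst hwu
        simp [contract, hw]
      · by_cases hwv : w = v
        · subst hwv
          simp [contract, h, hw]
        · simp [contract, hwu, hwv, hw]
    · rintro ⟨y, hy⟩ hj
      by_cases hyv : y = v
      · subst hyv
        simp only [if_true, mem_union] at hj
        rcases hj with hj | hj
        · rw [← huniq u hj]
          simp [contract]
        · rw [← huniq y hj]
          simp [contract, h]
      · simp only [hyv, if_false] at hj
        rw [← huniq y hj]
        simp [contract, hy]
  have h2 : ∀ x : {x // x ≠ u}, ∀ j ∈ (if x.1 = v then τ.ψ u ∪ τ.ψ v else τ.ψ x.1),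
      scope j ⊆ τ.χ x.1 := by
    rintro ⟨y, hy⟩ j hj
    by_cases hyv : y = v
    · subst hyv
      simp only [if_true, mem_union] at hj
      rcases hj with hj | hj
      · exact (τ.scope_subset _ j hj).trans hsub
      · exact τ.scope_subset _ j hj
    · simp only [hyv, if_false] at hj
      exact τ.scope_subset _ j hj
  have h3 : ∀ i, ((τ.tree.map (contract u v h)).induce {x | i ∈ τ.χ x.1}).Preconnected := by
    rintro i a b
    have hc : ∀ x : {w | i ∈ τ.χ w}, i ∈ τ.χ (contract u v h x.1).1 := by
      rintro ⟨x, hx⟩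
      by_cases hxu : x = u
      -- Redundancy is used here: `v` contains every variable of `u`.
      · subst hxu
        simpa [contract] using hsub hx
      · simpa [contract, hxu] using hx
    have := reachable_map
      (H := (τ.tree.map (contract u v h)).induce {x | i ∈ τ.χ x.1})
      (fun x : {w | i ∈ τ.χ w} =>
        (⟨contract u v h x.1, hc x⟩ : {x : {x // x ≠ u} | i ∈ τ.χ x.1}))
      (fun x y hxy => ?_) (τ.connected i ⟨a.1.1, a.2⟩ ⟨b.1.1, b.2⟩)
    · simpa only [contract_of_ne] using this
    · by_cases hcc : contract u v h x.1 = contract u v h y.1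
      · exact Or.inl (Subtype.ext hcc)
      · exact Or.inr ⟨hcc, x.1, y.1, hxy, rfl, rfl⟩
  obtain ⟨σ, f, hs, hχ, hψ⟩ := exists_treeDecomposition_equiv
    (isTree_map_contract τ.isTree h huv) _ _ h1 h2 h3
  refine ⟨σ, fun x => (f x).1, ?_, hχ, hψ⟩
  rw [hs, Fintype.card_subtype_compl, Fintype.card_subtype_eq, Fintype.card_fin]
  have := u.pos
  omega

/-- A single cluster holding everything. It shows that the infima defining the two widths are
attained. -/
theorem exists_treeDecomposition_isHypertree (scope : Fin r → Finset (Fin n))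
    (hcover : ∀ i, ∃ j, i ∈ scope j) : ∃ τ : TreeDecomposition scope, τ.IsHypertree := by
  obtain ⟨τ, f, -, hχ, hψ⟩ := exists_treeDecomposition_equiv (scope := scope)
    (V := Unit) (T := ⊥) SimpleGraph.IsTree.of_subsingleton (fun _ => univ) (fun _ => univ)
    (fun j => ⟨(), by simp⟩) (fun _ _ _ => subset_univ _)
    (fun i => SimpleGraph.Preconnected.of_subsingleton)
  refine ⟨τ, fun v => ?_⟩
  intro i _
  obtain ⟨j, hj⟩ := hcover i
  rw [hψ, mem_biUnion]
  exact ⟨j, mem_univ _, hj⟩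

/-- There is a tree-decomposition of least width without redundant clusters. -/
theorem exists_reduced_treeDecomposition (scope : Fin r → Finset (Fin n))
    (hcover : ∀ i, ∃ j, i ∈ scope j) :
    ∃ τ : TreeDecomposition scope, τ.width = treewidth scope ∧
      ∀ u v, τ.tree.Adj u v → ¬ τ.χ u ⊆ τ.χ v := by
  obtain ⟨τ₀, -⟩ := exists_treeDecomposition_isHypertree scope hcover
  have hmem := Nat.sInf_mem (s := {w | ∃ τ : TreeDecomposition scope, τ.width = w}) ⟨_, τ₀, rfl⟩
  -- Minimal size among the decompositions of width at most the treewidth makes every contraction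
  -- contradictory.
  obtain ⟨τ, hτ, hmin⟩ := WellFounded.has_min
    (measure fun τ : TreeDecomposition scope => τ.size).wf {τ | τ.width ≤ treewidth scope}
    (by obtain ⟨τ, hτ⟩ := hmem; exact ⟨τ, hτ.le⟩)
  refine ⟨τ, le_antisymm hτ (Nat.sInf_le ⟨τ, rfl⟩), fun u v huv hsub => ?_⟩
  obtain ⟨σ, f, hlt, hχ, -⟩ := τ.exists_contraction huv hsub
  refine hmin σ (le_trans (Nat.sub_le_sub_right (Finset.sup_le fun x _ => ?_) 1) hτ) hlt
  rw [hχ]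
  exact le_sup (f := fun v => #(τ.χ v)) (mem_univ _)

/-- There is a hypertree decomposition of least hypertree width all of whose clusters contain
functions. -/
theorem exists_reduced_hypertreeDecomposition (scope : Fin r → Finset (Fin n))
    (hcover : ∀ i, ∃ j, i ∈ scope j) (hr : 0 < r) :
    ∃ τ : TreeDecomposition scope, τ.IsHypertree ∧ τ.hyperwidth = hypertreewidth scope ∧
      ∀ u, (τ.ψ u).Nonempty := by
  obtain ⟨τ₀, h₀⟩ := exists_treeDecomposition_isHypertree scope hcover
  have hmem := Nat.sInf_mem
    (s := {w | ∃ τ : TreeDecomposition scope, τ.IsHypertree ∧ τ.hyperwidth = w}) ⟨_, τ₀, h₀, rfl⟩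
  obtain ⟨τ, ⟨hτ, hw⟩, hmin⟩ := WellFounded.has_min
    (measure fun τ : TreeDecomposition scope => τ.size).wf
    {τ | τ.IsHypertree ∧ τ.hyperwidth ≤ hypertreewidth scope}
    (by obtain ⟨τ, hτ, hw⟩ := hmem; exact ⟨τ, hτ, hw.le⟩)
  refine ⟨τ, hτ, le_antisymm hw (Nat.sInf_le ⟨τ, hτ, rfl⟩), fun u => ?_⟩
  by_contra hu
  rw [not_nonempty_iff_eq_empty] at hu
  -- The covering condition empties a cluster without functions, so any neighbour contains it.
  have hχu : τ.χ u = ∅ := by simpa [hu] using hτ u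
  -- Some function exists and sits in another cluster, so `u` has a neighbour to be contracted into.
  obtain ⟨x, hx, -⟩ := τ.existsUnique_mem ⟨0, hr⟩
  have hux : u ≠ x := by
    rintro rfl
    simp [hu] at hx
  obtain ⟨w⟩ := τ.isTree.connected.preconnected u x
  obtain ⟨v, huv, -⟩ := exists_first_step w hux
  obtain ⟨σ, f, hlt, hχ, hψ⟩ := τ.exists_contraction huv (by simp [hχu])
  have hψ' : ∀ x, σ.ψ x = τ.ψ (f x) := by
    intro x
    rw [hψ, hu, empty_union]
    split_ifs with h
    · rw [h]
    · rfl
  refine hmin σ ⟨fun x => ?_, le_trans (Finset.sup_le fun x _ => ?_) hw⟩ hlt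
  · rw [hχ, hψ']
    exact hτ _
  · rw [hψ']
    exact le_sup (f := fun v => #(τ.ψ v)) (mem_univ _)

/-- The sets `ψ v` partition the functions. -/
theorem TreeDecomposition.sum_card (τ : TreeDecomposition scope) : ∑ v, #(τ.ψ v) = r := by
  have hd : ((univ : Finset (Fin τ.size)) : Set (Fin τ.size)).PairwiseDisjoint τ.ψ := by
    intro a _ b _ hab
    rw [Function.onFun, Finset.disjoint_left]
    exact fun j ha hb => hab ((τ.existsUnique_mem j).unique ha hb)
  rw [← card_biUnion hd]
  have : (univ : Finset (Fin τ.size)).biUnion τ.ψ = univ := by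
    ext j
    obtain ⟨v, hv, -⟩ := τ.existsUnique_mem j
    simp only [mem_biUnion, mem_univ, true_and, iff_true]
    exact ⟨v, hv⟩
  rw [this, card_univ, Fintype.card_fin]

theorem TreeDecomposition.size_le_of_nonempty (τ : TreeDecomposition scope)
    (h : ∀ u, (τ.ψ u).Nonempty) : τ.size ≤ r := by
  conv_rhs => rw [← τ.sum_card]
  conv_lhs => rw [← Fintype.card_fin τ.size, ← card_univ, card_eq_sum_ones]
  exact sum_le_sum fun u _ => (h u).card_pos

end Contraction

/-! ### Summation over variables and the distributive law. -/

section Marginals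

variable {n : ℕ} {d : Fin n → ℕ}

/-- The sum of `F` over all full assignments that agree with `x` outside `S`. -/
def marg (S : Finset (Fin n)) (F : ((i : Fin n) → Fin (d i)) → ℚ) (x : (i : Fin n) → Fin (d i)) :
    ℚ :=
  ∑ y with ∀ i, i ∉ S → y i = x i, F y

theorem marg_empty (F : ((i : Fin n) → Fin (d i)) → ℚ) : marg ∅ F = F := by
  funext x
  have : (univ.filter fun y : (i : Fin n) → Fin (d i) => ∀ i, i ∉ (∅ : Finset (Fin n)) → y i = x i)
      = {x} := by
    ext y
    simp [funext_iff]
  rw [marg, this, sum_singleton]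

/-- Fubini: the assignments are grouped by their values on `S`, the other coordinates being reset to
those of `x`. -/
theorem marg_union {S S' : Finset (Fin n)} (h : Disjoint S S')
    (F : ((i : Fin n) → Fin (d i)) → ℚ) : marg (S ∪ S') F = marg S (marg S' F) := by
  funext x
  unfold marg
  refine (sum_fiberwise_of_maps_to (t := univ.filter fun y => ∀ i, i ∉ S → y i = x i)
    (g := fun z i => if i ∈ S then z i else x i) ?_ _).symm.trans ?_
  · intro z _
    rw [mem_filter_univ]
    exact fun i hi => if_neg hi
  · refine sum_congr rfl fun y hy => sum_congr ?_ fun _ _ => rfl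
    rw [mem_filter_univ] at hy
    ext z
    simp only [mem_filter, mem_univ, true_and, mem_union, not_or, and_imp, funext_iff]
    constructor
    · rintro ⟨h1, h2⟩ i hi
      rw [← h2 i]
      split_ifs with hS
      · rfl
      · exact h1 i hS hi
    · intro hz
      refine ⟨fun i hi hi' => by rw [hz i hi', hy i hi], fun i => ?_⟩
      split_ifs with hS
      · exact hz i (disjoint_left.1 h hS)
      · exact (hy i hS).symm

/-- `F` is constant over the range of summation. -/
theorem marg_mul_left {S A : Finset (Fin n)} {F G : ((i : Fin n) → Fin (d i)) → ℚ}
    (hF : DependsOn F (A : Set (Fin n))) (h : Disjoint A S) : marg S (F * G) = F * marg S G := by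
  funext x
  rw [Pi.mul_apply]
  unfold marg
  rw [mul_sum]
  refine sum_congr rfl fun y hy => ?_
  rw [mem_filter_univ] at hy
  rw [Pi.mul_apply, hF fun i hi => hy i (disjoint_left.1 h hi)]

theorem dependsOn_marg {S A B : Finset (Fin n)} {F : ((i : Fin n) → Fin (d i)) → ℚ}
    (hF : DependsOn F (A : Set (Fin n))) (h : A ⊆ B ∪ S) :
    DependsOn (marg S F) (B : Set (Fin n)) := by
  intro x x' hx
  unfold marg
  refine sum_nbij' (fun y i => if i ∈ S then y i else x' i) (fun y i => if i ∈ S then y i else x i)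
    ?_ ?_ ?_ ?_ ?_
  · intro y _
    rw [mem_filter_univ]
    exact fun i hi => if_neg hi
  · intro y _
    rw [mem_filter_univ]
    exact fun i hi => if_neg hi
  · intro y hy
    rw [mem_filter_univ] at hy
    funext i
    by_cases hi : i ∈ S
    · simp [hi]
    · simp [hi, hy]
  · intro y hy
    rw [mem_filter_univ] at hy
    funext i
    by_cases hi : i ∈ S
    · simp [hi]
    · simp [hi, hy]
  · intro y hy
    rw [mem_filter_univ] at hy
    refine hF fun i hi => ?_
    by_cases hS : i ∈ S
    · simp [hS]
    · rcases mem_union.1 (h hi) with hB | hS'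
      · simp [hS, hy, hx i hB]
      · exact absurd hS' hS

theorem dependsOn_prod {ι : Type*} {s : Finset ι} {F : ι → ((i : Fin n) → Fin (d i)) → ℚ}
    {B : Finset (Fin n)} (h : ∀ c ∈ s, DependsOn (F c) (B : Set (Fin n))) :
    DependsOn (∏ c ∈ s, F c) (B : Set (Fin n)) := by
  intro x y hxy
  rw [prod_apply, prod_apply]
  exact prod_congr rfl fun c hc => h c hc hxy

/-- `A c` consists of variables private to the factor `c`. No other factor reads them, so they can
be summed out inside it. -/
theorem marg_prod {ι : Type*} [DecidableEq ι] {s : Finset ι}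
    {F : ι → ((i : Fin n) → Fin (d i)) → ℚ} {A B : ι → Finset (Fin n)}
    (hF : ∀ c ∈ s, DependsOn (F c) (B c : Set (Fin n)))
    (hAB : ∀ c ∈ s, ∀ c' ∈ s, c ≠ c' → Disjoint (B c) (A c'))
    (hA : ∀ c ∈ s, A c ⊆ B c) :
    marg (s.biUnion A) (∏ c ∈ s, F c) = ∏ c ∈ s, marg (A c) (F c) := by
  induction s using Finset.induction_on with
  | empty => simp [marg_empty]
  | insert a s ha ih =>
    have ih' := ih (fun c hc => hF c (mem_insert_of_mem hc))
      (fun c hc c' hc' => hAB c (mem_insert_of_mem hc) c' (mem_insert_of_mem hc'))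
      (fun c hc => hA c (mem_insert_of_mem hc))
    have hne : ∀ c ∈ s, c ≠ a := fun c hc h => ha (h ▸ hc)
    rw [biUnion_insert, prod_insert ha, prod_insert ha, marg_union, marg_mul_left
      (hF a (mem_insert_self _ _)), ih', mul_comm, marg_mul_left, mul_comm]
    · refine dependsOn_prod (B := s.biUnion B) fun c hc => ?_
      refine dependsOn_marg (hF c (mem_insert_of_mem hc)) ?_
      exact (subset_biUnion_of_mem B hc).trans subset_union_left
    · rw [disjoint_biUnion_left]
      exact fun c hc => hAB c (mem_insert_of_mem hc) a (mem_insert_self _ _) (hne c hc)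
    · rw [disjoint_biUnion_right]
      exact fun c hc => hAB a (mem_insert_self _ _) c (mem_insert_of_mem hc) (hne c hc).symm
    · rw [disjoint_biUnion_right]
      exact fun c hc => disjoint_of_subset_left (hA a (mem_insert_self _ _))
        (hAB a (mem_insert_self _ _) c (mem_insert_of_mem hc) (hne c hc).symm)

/-- Sum-product message passing is correct at a cluster `u` if the messages of its children are. -/
theorem TreeDecomposition.marg_message {r : ℕ} {scope : Fin r → Finset (Fin n)}
    (τ : TreeDecomposition scope) {g : Fin τ.size → ((i : Fin n) → Fin (d i)) → ℚ}
    (hg : ∀ v, DependsOn (g v) (τ.χ v : Set (Fin n)))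
    {p : Option (Fin τ.size)} {u : Fin τ.size} (hp : ∀ q, p = some q → τ.tree.Adj u q)
    {sep : Finset (Fin n)} (hsep : sep ⊆ τ.χ u) :
    marg (τ.χ u \ sep) (g u * ∏ c ∈ τ.childSet p u,
        marg (τ.vars (some u) c \ (τ.χ u ∩ τ.χ c)) (∏ v ∈ side τ.tree (some u) c, g v)) =
      marg (τ.vars p u \ sep) (∏ v ∈ side τ.tree p u, g v) := by
  -- A variable of the child's side that lies in `χ u` lies in the separator, so the child has
  -- eliminated exactly its variables outside `χ u`.
  have hvars : ∀ c ∈ τ.childSet p u,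
      τ.vars (some u) c \ (τ.χ u ∩ τ.χ c) = τ.vars (some u) c \ τ.χ u := by
    intro c hc
    ext i
    simp only [mem_sdiff, mem_inter, not_and]
    refine and_congr_right fun hi => ⟨fun h hu => ?_, fun h hu => absurd hu h⟩
    exact h hu (τ.mem_of_mem_vars (τ.mem_childSet.1 hc).1 hi hu)
  have hunion : τ.vars p u \ sep =
      (τ.χ u \ sep) ∪ (τ.childSet p u).biUnion fun c => τ.vars (some u) c \ τ.χ u := by
    rw [τ.vars_eq hp]
    ext i
    simp only [mem_sdiff, mem_union, mem_biUnion]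
    constructor
    · rintro ⟨h | ⟨c, hc, h⟩, hs⟩
      · exact Or.inl ⟨h, hs⟩
      · by_cases hu : i ∈ τ.χ u
        · exact Or.inl ⟨hu, hs⟩
        · exact Or.inr ⟨c, hc, h, hu⟩
    · rintro (⟨h, hs⟩ | ⟨c, hc, h, hu⟩)
      · exact ⟨Or.inl h, hs⟩
      · exact ⟨Or.inr ⟨c, hc, h⟩, fun hs => hu (hsep hs)⟩
  have hdisj : Disjoint (τ.χ u) ((τ.childSet p u).biUnion fun c => τ.vars (some u) c \ τ.χ u) := by
    rw [disjoint_biUnion_right]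
    exact fun c _ => disjoint_sdiff
  rw [hunion, marg_union (disjoint_of_subset_left sdiff_subset hdisj), τ.prod_side hp,
    marg_mul_left (hg u) hdisj, marg_prod (B := fun c => τ.vars (some u) c)]
  · congr 2
    exact prod_congr rfl fun c hc => by rw [hvars c hc]
  · intro c _
    refine dependsOn_prod fun v hv => (hg v).mono ?_
    exact_mod_cast subset_biUnion_of_mem τ.χ hv
  · intro c hc c' hc' hne
    rw [Finset.disjoint_left]
    intro i hi hi'
    rw [mem_sdiff] at hi'
    exact hi'.2 (τ.mem_of_mem_vars_of_mem_vars (τ.mem_childSet.1 hc).1 (τ.mem_childSet.1 hc').1 hne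
      hi hi'.1)
  · exact fun c _ => sdiff_subset

end Marginals

/-! ### Hoare-style rules for metered computations. -/

section Specifications

/-- The result and the final meter of a computation. -/
def exec {α : Type} (p : Metered α) (s : Meter) : α × Meter := p s

/-- A computation that owns `a` entries of working memory takes time at most `T`, has a peak of at
most `P` entries, sends at most `S` entries, and ends with a result that satisfies `Q`, owning
`b` entries. -/
def Spec {α : Type} (a : ℕ) (p : Metered α) (T P S : ℕ) (Q : α → Prop) (b : α → ℕ) : Prop :=
  ∀ L s, s.live = L + a → Q (exec p s).1 ∧ (exec p s).2.live = L + b (exec p s).1 ∧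
    (exec p s).2.time ≤ s.time + T ∧ (exec p s).2.peak ≤ max s.peak (L + P) ∧
    (exec p s).2.sent ≤ s.sent + S

variable {α β : Type} {a T T' P P' S S' : ℕ} {Q Q' : α → Prop} {b : α → ℕ}

theorem Spec.mono {p : Metered α} (h : Spec a p T P S Q b) (hT : T ≤ T') (hP : P ≤ P')
    (hS : S ≤ S') (hQ : ∀ x, Q x → Q' x) : Spec a p T' P' S' Q' b := by
  intro L s hs
  obtain ⟨h1, h2, h3, h4, h5⟩ := h L s hs
  exact ⟨hQ _ h1, h2, by omega, by omega, by omega⟩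

theorem Spec.pure {x : α} (hQ : Q x) (hb : b x = a) : Spec a (pure x : Metered α) 0 P 0 Q b := by
  intro L s hs
  exact ⟨hQ, hs.trans (hb ▸ rfl), le_rfl, le_max_left _ _, le_rfl⟩

theorem Spec.pure_of_eq {x : α} (hQ : Q x) (hb : b x = a) :
    Spec a (Pure.pure x : Metered α) T P S Q b :=
  (Spec.pure (P := P) hQ hb).mono (Nat.zero_le _) le_rfl (Nat.zero_le _) fun _ h => h

/-- Time and traffic add, whereas both parts share one bound on the peak. -/
theorem Spec.bind {p : Metered α} {f : α → Metered β} {R : β → Prop} {c : β → ℕ}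
    (h : Spec a p T P S Q b) (h' : ∀ x, Q x → Spec (b x) (f x) T' P S' R c) :
    Spec a (p >>= f) (T + T') P (S + S') R c := by
  intro L s hs
  obtain ⟨h1, h2, h3, h4, h5⟩ := h L s hs
  obtain ⟨g1, g2, g3, g4, g5⟩ := h' _ h1 L _ h2
  have he : exec (p >>= f) s = exec (f (exec p s).1) (exec p s).2 := rfl
  rw [he]
  exact ⟨g1, g2, by omega, by omega, by omega⟩

theorem Spec.tick_bind {p : Metered α} (c : ℕ) (h : Spec a p T P S Q b) :
    Spec a (tick c >>= fun _ => p) (c + T) P S Q b := by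
  intro L s hs
  obtain ⟨h1, h2, h3, h4, h5⟩ := h L { s with time := s.time + c } hs
  exact ⟨h1, h2, by rw [← add_assoc]; exact h3, h4, h5⟩

theorem Spec.alloc_bind {p : Metered α} (c : ℕ) (hP : a + c ≤ P) (h : Spec (a + c) p T P S Q b) :
    Spec a (alloc c >>= fun _ => p) T P S Q b := by
  intro L s hs
  obtain ⟨h1, h2, h3, h4, h5⟩ := h L
    { s with live := s.live + c, peak := max s.peak (s.live + c) } (by simp only [hs]; omega)
  refine ⟨h1, h2, h3, h4.trans ?_, h5⟩
  simp only
  omega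

/-- The released entries are owned beforehand, so the truncated subtraction in the meter is exact.
-/
theorem Spec.free_bind {p : Metered α} (c : ℕ) (h : Spec a p T P S Q b) :
    Spec (a + c) (free c >>= fun _ => p) T P S Q b := by
  intro L s hs
  exact h L { s with live := s.live - c } (by simp only [hs]; omega)

theorem Spec.emit_bind {p : Metered α} (c : ℕ) (h : Spec a p T P S Q b) :
    Spec (a + c) (emit c >>= fun _ => p) T P (c + S) Q b := by
  intro L s hs
  obtain ⟨h1, h2, h3, h4, h5⟩ := h L { s with live := s.live - c, sent := s.sent + c }
    (by simp only [hs]; omega)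
  exact ⟨h1, h2, h3, h4, by rw [← add_assoc]; exact h5⟩

theorem Spec.emit_pure {x : α} {c : ℕ} (hQ : Q x) (hb : b x = 0) (hc : c ≤ S) :
    Spec c (emit c >>= fun _ => Pure.pure x) T P S Q b := by
  have h := (Spec.emit_bind c (Spec.pure (P := P) hQ hb)).mono (Nat.zero_le T) le_rfl hc
    fun _ h => h
  rwa [zero_add] at h

/-- The rule for loops. The invariant refers to the part of the list that is still to be read. -/
theorem Spec.foldlM {o : α → ℕ} {step : α → β → Metered α} (Inv : List β → α → Prop) {c : ℕ}
    (hstep : ∀ x l y, Inv (x :: l) y → Spec (o y) (step y x) c P 0 (Inv l) o) (l : List β) :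
    ∀ y, Inv l y → Spec (o y) (l.foldlM step y) (c * l.length) P 0 (Inv []) o := by
  induction l with
  | nil => exact fun y hy => Spec.pure hy rfl
  | cons x l ih =>
    intro y hy
    rw [List.foldlM_cons]
    refine (Spec.bind (hstep x l y hy) fun z hz => ih z hz).mono ?_ le_rfl le_rfl fun _ h => h
    rw [List.length_cons]
    ring_nf
    exact le_rfl

/-- Each computation starts and ends without working memory of its own, so the peak is a common
bound and not a sum. -/
theorem Spec.mapM {ι : Type} {f : ι → Metered β} {R : ι → β → Prop} {T S : ι → ℕ} (l : List ι)
    (h : ∀ c ∈ l, Spec 0 (f c) (T c) P (S c) (R c) fun _ => 0) :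
    Spec 0 (l.mapM f) (l.map T).sum P (l.map S).sum (List.Forall₂ R l) fun _ => 0 := by
  induction l with
  | nil => exact Spec.pure .nil rfl
  | cons c l ih =>
    rw [List.mapM_cons, List.map_cons, List.map_cons, List.sum_cons, List.sum_cons]
    refine Spec.bind (h c List.mem_cons_self) fun x hx => ?_
    exact Spec.bind (T' := 0) (S' := 0) (ih fun c hc => h c (List.mem_cons_of_mem _ hc))
      fun xs hxs => Spec.pure (.cons hx hxs) rfl

theorem map_eq_map_of_forall₂ {ι κ β : Type*} {R : ι → β → Prop} {l : List ι} {l' : List β}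
    {f : β → κ} {g : ι → κ} (h : List.Forall₂ R l l') (hR : ∀ a b, R a b → f b = g a) :
    l'.map f = l.map g := by
  induction h with
  | nil => rfl
  | cons h _ ih => rw [List.map_cons, List.map_cons, hR _ _ h, ih]

theorem forall_mem_of_forall₂ {ι β : Type*} {R : ι → β → Prop} {p : β → Prop} {l : List ι}
    {l' : List β} (h : List.Forall₂ R l l') (hR : ∀ a b, R a b → p b) : ∀ b ∈ l', p b := by
  induction h with
  | nil => simp
  | cons h _ ih => exact List.forall_mem_cons.2 ⟨hR _ _ h, ih⟩

end Specifications

/-! ### Induction over the rooted cluster tree. -/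

section MessagePassing

variable {n r : ℕ} {d : Fin n → ℕ} {scope : Fin r → Finset (Fin n)}

/-- Cluster-tree elimination is correct, and its resources add up over the clusters, if this holds
for the computation of a single message. -/
theorem collect_spec (τ : TreeDecomposition scope) {β : Type}
    {send : Fin τ.size → Finset (Fin n) → List (Finset (Fin n) × β) → Metered β}
    {Valid : Finset (Fin n) → β → Prop} {read : Finset (Fin n) → β → ((i : Fin n) → Fin (d i)) → ℚ}
    {g : Fin τ.size → ((i : Fin n) → Fin (d i)) → ℚ} {Good : Finset (Fin n) → Prop}
    {A : Fin τ.size → ℕ} {B P S : ℕ}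
    (hg : ∀ v, DependsOn (g v) (τ.χ v : Set (Fin n)))
    (hGood : ∀ u c, τ.tree.Adj u c → Good (τ.χ u ∩ τ.χ c))
    (hsend : ∀ u sep msgs, sep ⊆ τ.χ u → Good sep → (∀ m ∈ msgs, m.1 ⊆ τ.χ u ∧ Valid m.1 m.2) →
      Spec 0 (send u sep msgs) (A u + B * msgs.length) P S
        (fun m => Valid sep m ∧
          read sep m = marg (τ.χ u \ sep) (g u * (msgs.map fun m => read m.1 m.2).prod))
        fun _ => 0)
    (depth : ℕ) : ∀ p u sep, (∀ q, p = some q → τ.tree.Adj u q) → sep ⊆ τ.χ u → Good sep →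
      #(side τ.tree p u) ≤ depth →
      Spec 0 (collect τ send depth p u sep) (∑ v ∈ side τ.tree p u, (A v + B + 1) - B) P
        (S * #(side τ.tree p u))
        (fun m => Valid sep m ∧
          read sep m = marg (τ.vars p u \ sep) (∏ v ∈ side τ.tree p u, g v))
        fun _ => 0 := by
  induction depth with
  | zero =>
    intro p u sep hp _ _ hd
    -- Depth `0` cannot occur: a side contains its own top cluster.
    have := card_pos.2 ⟨u, self_mem_side (T := τ.tree) (τ.ne_some_of_adj hp)⟩
    omega
  | succ depth ih =>
    intro p u sep hp hsep hgood hd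
    -- Every cluster is charged `B` for the receipt of its message by its parent. The message of the
    -- top cluster is received outside its side, whence the `- B` in the time bound. This inequality
    -- makes that subtraction exact for the children.
    have hW : ∀ c ∈ τ.childSet p u, B ≤ ∑ v ∈ side τ.tree (some u) c, (A v + B + 1) := by
      intro c hc
      refine le_trans ?_ (single_le_sum (f := fun v => A v + B + 1) (fun _ _ => Nat.zero_le _)
        (self_mem_side (τ.ne_some_of_adj (τ.adj_of_mem_childSet hc))))
      omega
    have hmap := Spec.mapM (τ.children p u) (P := P)
      (f := fun c => do
        let m ← collect τ send depth (some u) c (τ.χ u ∩ τ.χ c)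
        pure (τ.χ u ∩ τ.χ c, m))
      (T := fun c => ∑ v ∈ side τ.tree (some u) c, (A v + B + 1) - B)
      (S := fun c => S * #(side τ.tree (some u) c))
      (R := fun c m => (m.1 ⊆ τ.χ u ∧ Valid m.1 m.2) ∧
        read m.1 m.2 = marg (τ.vars (some u) c \ (τ.χ u ∩ τ.χ c))
          (∏ v ∈ side τ.tree (some u) c, g v))
      (fun c hc => by
        have hc' : c ∈ τ.childSet p u := List.mem_toFinset.2 hc
        refine Spec.bind (T' := 0) (S' := 0) (ih (some u) c (τ.χ u ∩ τ.χ c)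
          (τ.adj_of_mem_childSet hc') inter_subset_right
          (hGood _ _ (τ.mem_childSet.1 hc').1) ?_) fun m hm =>
            Spec.pure ⟨⟨inter_subset_left, hm.1⟩, hm.2⟩ rfl
        have h1 := τ.card_side hp
        have h2 := single_le_sum (f := fun c => #(side τ.tree (some u) c))
          (fun _ _ => Nat.zero_le _) hc'
        omega)
    rw [← List.sum_toFinset _ (τ.nodup_children p u), ← List.sum_toFinset _ (τ.nodup_children p u)]
      at hmap
    change Spec _ _ (∑ c ∈ τ.childSet p u, _) _ (∑ c ∈ τ.childSet p u, _) _ _ at hmap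
    rw [collect]
    refine (Spec.tick_bind 1 (Spec.bind hmap
      (T' := A u + B * #(τ.childSet p u)) (S' := S) fun msgs hmsgs => ?_)).mono ?_ le_rfl ?_
      fun _ h => h
    · have hlen : msgs.length = #(τ.childSet p u) := by
        rw [← hmsgs.length_eq, TreeDecomposition.childSet,
          List.toFinset_card_of_nodup (τ.nodup_children p u)]
      have hprod : (msgs.map fun m => read m.1 m.2).prod = ∏ c ∈ τ.childSet p u,
          marg (τ.vars (some u) c \ (τ.χ u ∩ τ.χ c)) (∏ v ∈ side τ.tree (some u) c, g v) := by
        rw [TreeDecomposition.childSet, List.prod_toFinset _ (τ.nodup_children p u)]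
        rw [map_eq_map_of_forall₂ hmsgs fun c m h => h.2]
      have hvalid : ∀ m ∈ msgs, m.1 ⊆ τ.χ u ∧ Valid m.1 m.2 :=
        forall_mem_of_forall₂ hmsgs fun c m h => h.1
      have := hsend u sep msgs hsep hgood hvalid
      rw [hlen, hprod, τ.marg_message hg hp hsep] at this
      exact this
    · have h1 : ∑ c ∈ τ.childSet p u, (∑ v ∈ side τ.tree (some u) c, (A v + B + 1) - B) +
          B * #(τ.childSet p u) =
          ∑ c ∈ τ.childSet p u, ∑ v ∈ side τ.tree (some u) c, (A v + B + 1) := by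
        rw [mul_comm, ← smul_eq_mul, ← sum_const, ← sum_add_distrib]
        exact sum_congr rfl fun c hc => Nat.sub_add_cancel (hW c hc)
      rw [τ.sum_side hp]
      omega
    · rw [τ.card_side hp, mul_add, mul_sum]
      omega

end MessagePassing

/-! ### Configurations as projections of full assignments. -/

section Tuples

variable {n : ℕ} {d : Fin n → ℕ}

theorem restrict_full_eq_iff {x y : (i : Fin n) → Fin (d i)} {S : Finset (Fin n)} :
    restrict (full x) S = restrict (full y) S ↔ ∀ i ∈ S, x i = y i := by
  constructor
  · intro h i hi
    have := congrFun h i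
    simpa [restrict, full, hi] using this
  · intro h
    funext i
    by_cases hi : i ∈ S
    · simp [restrict, full, hi, h i hi]
    · simp [restrict, hi]

theorem restrict_restrict {x : Tuple d} {S S' : Finset (Fin n)} (h : S' ⊆ S) :
    restrict (restrict x S) S' = restrict x S' := by
  funext i
  by_cases hi : i ∈ S'
  · simp [restrict, hi, h hi]
  · simp [restrict, hi]

theorem mem_configs {x : Tuple d} {S : Finset (Fin n)} :
    x ∈ configs d S ↔ ∀ i, (x i).isSome = true ↔ i ∈ S := by
  simp [configs]

theorem restrict_full_mem_configs (x : (i : Fin n) → Fin (d i)) (S : Finset (Fin n)) :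
    restrict (full x) S ∈ configs d S := by
  rw [mem_configs]
  intro i
  by_cases hi : i ∈ S <;> simp [restrict, full, hi]

theorem restrict_mem_configs {x : Tuple d} {S S' : Finset (Fin n)} (hx : x ∈ configs d S)
    (h : S' ⊆ S) : restrict x S' ∈ configs d S' := by
  rw [mem_configs] at hx ⊢
  intro i
  by_cases hi : i ∈ S'
  · simpa [restrict, hi] using (hx i).2 (h hi)
  · simp [restrict, hi]

/-- A configuration is completed by a full assignment. -/
def complete (z : Tuple d) (x : (i : Fin n) → Fin (d i)) : (i : Fin n) → Fin (d i) :=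
  fun i => (z i).getD (x i)

theorem restrict_full_complete {z : Tuple d} {S : Finset (Fin n)} (hz : z ∈ configs d S)
    (x : (i : Fin n) → Fin (d i)) : restrict (full (complete z x)) S = z := by
  rw [mem_configs] at hz
  funext i
  have := hz i
  cases hi : z i with
  | none => simp [hi] at this; simp [restrict, this]
  | some a => simp [hi] at this; simp [restrict, full, complete, this, hi]

theorem card_configs (S : Finset (Fin n)) : #(configs d S) = cells d S := by
  classical
  have : configs d S = Fintype.piFinset fun i =>
      if i ∈ S then (univ.image some : Finset (Option (Fin (d i)))) else {none} := by
    ext x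
    rw [mem_configs, Fintype.mem_piFinset]
    refine forall_congr' fun i => ?_
    cases hx : x i <;> by_cases hi : i ∈ S <;> simp [hi]
  rw [this, Fintype.card_piFinset, cells, ← prod_subset (subset_univ S)]
  · refine prod_congr rfl fun i hi => ?_
    rw [if_pos hi, card_image_of_injective _ (Option.some_injective _), card_univ,
      Fintype.card_fin]
  · intro i _ hi
    rw [if_neg hi, card_singleton]

/-- Translates sums over full assignments, used for correctness, into the sums over cluster
configurations that the programs perform. -/
theorem marg_eq_sum_configs {S sep : Finset (Fin n)} (hsep : sep ⊆ S) (h : Tuple d → ℚ)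
    (x : (i : Fin n) → Fin (d i)) :
    marg (S \ sep) (fun y => h (restrict (full y) S)) x =
      ∑ z ∈ configs d S, if restrict z sep = restrict (full x) sep then h z else 0 := by
  rw [← sum_filter]
  unfold marg
  refine sum_nbij' (fun y => restrict (full y) S) (fun z => complete z x) ?_ ?_ ?_ ?_ ?_
  · intro y hy
    rw [mem_filter_univ] at hy
    rw [mem_filter, restrict_restrict hsep, restrict_full_eq_iff]
    exact ⟨restrict_full_mem_configs _ _, fun i hi => hy i (by simp [hi])⟩
  · intro z hz
    rw [mem_filter] at hz
    rw [mem_filter_univ]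
    intro i hi
    rw [mem_sdiff, not_and_not_right] at hi
    have h1 := mem_configs.1 hz.1 i
    cases hzi : z i with
    | none => simp [complete, hzi]
    | some a =>
      simp only [hzi, Option.isSome_some, true_iff] at h1
      have h2 := congrFun hz.2 i
      simp only [restrict, hi h1, if_true, full, hzi, Option.some.injEq] at h2
      simpa [complete, hzi] using h2
  · intro y hy
    rw [mem_filter_univ] at hy
    funext i
    by_cases hi : i ∈ S
    · simp [complete, restrict, full, hi]
    · simp [complete, restrict, hi, hy]
  · intro z hz
    rw [mem_filter] at hz
    exact restrict_full_complete hz.1 x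
  · exact fun _ _ => rfl

theorem compatible_full_restrict_iff {x y : (i : Fin n) → Fin (d i)} {S : Finset (Fin n)} :
    Compatible (full x) (restrict (full y) S) ↔ ∀ i ∈ S, x i = y i := by
  refine forall_congr' fun i => ?_
  by_cases hi : i ∈ S <;> simp [restrict, full, hi]

end Tuples

/-! ### Cluster factors with evidence. -/

section Factors

variable {n r : ℕ} {d : Fin n → ℕ} (M : GraphicalModel d r) (τ : TreeDecomposition M.scope)
  (e : Tuple d)

theorem GraphicalModel.value_restrict {S : Finset (Fin n)} {j : Fin r} (h : M.scope j ⊆ S)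
    (x : Tuple d) : M.value j (restrict x S) = M.value j x := by
  rw [GraphicalModel.value, GraphicalModel.value, restrict_restrict h]

/-- The product of the functions placed in a cluster, restricted to the evidence, on the
configurations of the cluster. -/
def clusterFunc (v : Fin τ.size) (z : Tuple d) : ℚ :=
  if Compatible z e then ∏ j ∈ τ.ψ v, M.value j z else 0

/-- The product of the functions placed in a cluster, restricted to the evidence. -/
def factor (v : Fin τ.size) (x : (i : Fin n) → Fin (d i)) : ℚ :=
  clusterFunc M τ e v (restrict (full x) (τ.χ v))

theorem dependsOn_factor (v : Fin τ.size) :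
    DependsOn (factor M τ e v) (τ.χ v : Set (Fin n)) := by
  intro x y hxy
  unfold factor
  rw [restrict_full_eq_iff.2 hxy]

/-- Each cluster tests only its own part of the evidence. Together they test all of it, because
every variable occurs in some scope and hence in some cluster. -/
theorem prod_factor (hcover : ∀ i, ∃ j, i ∈ M.scope j) (x : (i : Fin n) → Fin (d i)) :
    ∏ v, factor M τ e v x = if Compatible (full x) e then ∏ j, M.value j (full x) else 0 := by
  unfold factor clusterFunc
  split_ifs with h
  · have h1 : ∀ v, Compatible (restrict (full x) (τ.χ v)) e := by
      intro v i
      by_cases hi : i ∈ τ.χ v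
      · simpa [restrict, hi] using h i
      · simp [restrict, hi]
    have h2 : ∏ v, (if Compatible (restrict (full x) (τ.χ v)) e then
        ∏ j ∈ τ.ψ v, M.value j (restrict (full x) (τ.χ v)) else 0) =
        ∏ v, ∏ j ∈ τ.ψ v, M.value j (full x) := by
      refine prod_congr rfl fun v _ => ?_
      rw [if_pos (h1 v)]
      exact prod_congr rfl fun j hj => M.value_restrict (τ.scope_subset v j hj) _
    rw [h2, ← prod_biUnion]
    · congr 1
      ext j
      obtain ⟨v, hv, -⟩ := τ.existsUnique_mem j
      simp only [mem_biUnion, mem_univ, true_and, iff_true]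
      exact ⟨v, hv⟩
    · intro a _ b _ hab
      rw [Function.onFun, Finset.disjoint_left]
      exact fun j ha hb => hab ((τ.existsUnique_mem j).unique ha hb)
  · unfold Compatible at h
    push Not at h
    obtain ⟨i, hi1, hi2, hi3⟩ := h
    obtain ⟨j, hj⟩ := hcover i
    obtain ⟨v, hv, -⟩ := τ.existsUnique_mem j
    refine prod_eq_zero (mem_univ v) (if_neg fun hc => ?_)
    have := hc i
    simp only [restrict, τ.scope_subset v j hv hj, if_true] at this
    tauto

theorem marg_prod_factor (hcover : ∀ i, ∃ j, i ∈ M.scope j) (Q : Finset (Fin n))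
    (root : Fin τ.size) (x : (i : Fin n) → Fin (d i)) :
    marg (τ.vars none root \ Q) (∏ v ∈ side τ.tree none root, factor M τ e v) x =
      M.sumProduct e (restrict (full x) Q) := by
  have hvars : τ.vars none root = univ := by
    ext i
    obtain ⟨j, hj⟩ := hcover i
    obtain ⟨v, hv, -⟩ := τ.existsUnique_mem j
    simp only [TreeDecomposition.vars, side_none τ.isTree.connected, mem_biUnion, mem_univ,
      true_and, iff_true]
    exact ⟨v, τ.scope_subset v j hv hj⟩
  rw [hvars, side_none τ.isTree.connected]
  unfold marg GraphicalModel.sumProduct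
  rw [sum_filter]
  refine sum_congr rfl fun y _ => ?_
  rw [prod_apply, prod_factor M τ e hcover]
  simp only [compatible_full_restrict_iff, mem_sdiff, mem_univ, true_and, not_not]
  split_ifs <;> tauto

end Factors

/-! ### The cost and correctness of one tabular message. -/

section Tables

variable {n r : ℕ} {d : Fin n → ℕ}

theorem foldl_update_apply {ι κ : Type*} [DecidableEq κ] (C : ι → Prop) [DecidablePred C]
    (k : ι → κ) (f : ι → ℚ) (l : List ι) (t : κ → ℚ) (y : κ) :
    l.foldl (fun t x => if C x then Function.update t (k x) (t (k x) + f x) else t) t y =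
      t y + (l.map fun x => if k x = y then (if C x then f x else 0) else 0).sum := by
  induction l generalizing t with
  | nil => simp
  | cons x l ih =>
    rw [List.foldl_cons, ih, List.map_cons, List.sum_cons, ← add_assoc]
    congr 1
    by_cases hC : C x
    · by_cases hk : k x = y
      · subst hk
        simp [hC]
      · simp [hC, hk, Function.update_of_ne (Ne.symm hk)]
    · simp [hC]

theorem foldl_mul {ι : Type*} (f : ι → ℚ) (l : List ι) (a : ℚ) :
    l.foldl (fun p j => p * f j) a = a * (l.map f).prod := by
  induction l generalizing a with
  | nil => simp
  | cons x l ih => rw [List.foldl_cons, ih, List.map_cons, List.prod_cons, mul_assoc]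

/-- A loop all of whose steps cost the same and keep the working memory. -/
theorem Spec.foldlM_const {α β : Type} {a c P : ℕ} {step : α → β → Metered α} (f : α → β → α)
    (hstep : ∀ y x, Spec a (step y x) c P 0 (fun z => z = f y x) fun _ => a) (l : List β) (y : α) :
    Spec a (l.foldlM step y) (c * l.length) P 0 (fun z => z = l.foldl f y) fun _ => a := by
  refine Spec.foldlM (o := fun _ => a) (fun l' z => l'.foldl f z = l.foldl f y) ?_ l y rfl
  intro x l' z hz
  refine (hstep z x).mono le_rfl le_rfl le_rfl ?_
  rintro w rfl
  exact hz

/-- `ρ` reads a stored message as a function, so that one statement serves tables and relations. -/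
theorem marg_factor_mul (M : GraphicalModel d r) (τ : TreeDecomposition M.scope) (e : Tuple d)
    (u : Fin τ.size) {β : Type} (ρ : β → Tuple d → ℚ) {sep : Finset (Fin n)} (hsep : sep ⊆ τ.χ u)
    {msgs : List (Finset (Fin n) × β)} (hmsgs : ∀ m ∈ msgs, m.1 ⊆ τ.χ u)
    (x : (i : Fin n) → Fin (d i)) :
    marg (τ.χ u \ sep)
        (factor M τ e u * (msgs.map fun m x => ρ m.2 (restrict (full x) m.1)).prod) x =
      ∑ z ∈ configs d (τ.χ u), if restrict z sep = restrict (full x) sep then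
        clusterFunc M τ e u z * (msgs.map fun m => ρ m.2 (restrict z m.1)).prod else 0 := by
  rw [← marg_eq_sum_configs hsep]
  congr 1
  funext y
  rw [Pi.mul_apply, factor]
  congr 1
  induction msgs with
  | nil => simp
  | cons m l ih =>
    rw [List.forall_mem_cons] at hmsgs
    rw [List.map_cons, List.map_cons, List.prod_cons, List.prod_cons, Pi.mul_apply, ih hmsgs.2,
      restrict_restrict hmsgs.1]

/-- Only the outgoing table occupies memory. A configuration costs `2` for the scan, `2` per
function, `3` per message and `3` for the update. -/
theorem sendTable_spec (M : GraphicalModel d r) (τ : TreeDecomposition M.scope) (e : Tuple d)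
    (u : Fin τ.size) (sep : Finset (Fin n)) (msgs : List (Finset (Fin n) × (Tuple d → ℚ)))
    (hsep : sep ⊆ τ.χ u) (hmsgs : ∀ m ∈ msgs, m.1 ⊆ τ.χ u) :
    Spec 0 (sendTable M τ e u sep msgs)
      (cells d sep + (5 + 2 * #(τ.ψ u) + 3 * msgs.length) * cells d (τ.χ u))
      (cells d sep) (cells d sep)
      (fun t => (fun x => t (restrict (full x) sep)) = marg (τ.χ u \ sep)
        (factor M τ e u * (msgs.map fun m x => m.2 (restrict (full x) m.1)).prod))
      fun _ => 0 := by
  -- The leading `1` is the initial value of the product.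
  set f : Tuple d → ℚ := fun z => 1 * ((τ.ψ u).toList.map fun j => M.value j z).prod *
    (msgs.map fun m => m.2 (restrict z m.1)).prod with hf
  have hloop := Spec.foldlM_const (a := cells d sep) (P := cells d sep)
    (c := 5 + 2 * #(τ.ψ u) + 3 * msgs.length)
    (step := fun (table : Tuple d → ℚ) x => do
      tick 2
      if Compatible x e then do
        let p ← (τ.ψ u).toList.foldlM
          (fun p j => do tick 2; pure (p * M.value j x)) (1 : ℚ)
        let p ← msgs.foldlM
          (fun p m => do tick 3; pure (p * m.2 (restrict x m.1))) p
        tick 3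
        let y := restrict x sep
        pure (Function.update table y (table y + p))
      else pure table)
    (fun t x => if Compatible x e then
      Function.update t (restrict x sep) (t (restrict x sep) + f x) else t)
    (by
      intro t x
      have h1 := Spec.foldlM_const (a := cells d sep) (P := cells d sep) (c := 2)
        (fun (p : ℚ) j => p * M.value j x)
        (step := fun p j => do tick 2; pure (p * M.value j x))
        (fun p j => Spec.tick_bind (T := 0) 2 (Spec.pure rfl rfl)) (τ.ψ u).toList 1
      have h2 := fun p : ℚ => Spec.foldlM_const (a := cells d sep) (P := cells d sep) (c := 3)
        (fun (p : ℚ) (m : Finset (Fin n) × (Tuple d → ℚ)) => p * m.2 (restrict x m.1))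
        (step := fun p m => do tick 3; pure (p * m.2 (restrict x m.1)))
        (fun p j => Spec.tick_bind (T := 0) 3 (Spec.pure rfl rfl)) msgs p
      simp only [foldl_mul] at h1 h2
      split_ifs with hc
      · refine Spec.mono (T := 2 + (2 * (τ.ψ u).toList.length + (3 * msgs.length + (3 + 0))))
          (S := 0 + (0 + 0)) ?_ ?_ le_rfl le_rfl fun _ h => h
        · refine Spec.tick_bind 2 (Spec.bind h1 fun p hp => Spec.bind (h2 p) fun q hq =>
            Spec.tick_bind 3 (Spec.pure ?_ rfl))
          rw [hq, hp]
        · rw [length_toList]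
          omega
      · refine Spec.mono (T := 2 + 0) (S := 0) ?_ (by omega) le_rfl le_rfl fun _ h => h
        exact Spec.tick_bind 2 (Spec.pure rfl rfl))
    (configs d (τ.χ u)).toList (fun _ => 0)
  rw [length_toList, card_configs] at hloop
  unfold sendTable
  refine Spec.alloc_bind _ (by omega) (Spec.tick_bind _ ?_)
  refine Spec.mono (S := 0 + (cells d sep + 0)) (T := _ + 0) (Spec.bind (b := fun _ =>
    0 + cells d sep) (by rw [zero_add]; exact hloop) fun t ht => Spec.emit_bind _ (Spec.pure ?_ rfl))
    le_rfl le_rfl (by omega) fun _ h => h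
  rw [ht]
  funext x
  rw [marg_factor_mul M τ e u (fun t => t) hsep hmsgs, foldl_update_apply, sum_map_toList, zero_add]
  refine sum_congr rfl fun z _ => ?_
  simp only [hf, clusterFunc, one_mul, prod_map_toList]
  split_ifs <;> simp

end Tables

/-! ### Relations: lookup, products, sorting, joins and grouping. -/

section Relations

variable {n : ℕ} {d : Fin n → ℕ}

/-- Makes the order by codes a linear order on tuples, on which joins and the grouping of runs rely.
-/
theorem code_injective : Function.Injective (code : Tuple d → List ℕ) := by
  intro x y h
  have := List.ofFn_injective h
  funext i
  have hi := congrFun this i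
  cases hx : x i <;> cases hy : y i <;> simp [hx, hy] at hi ⊢
  exact Fin.ext hi

theorem lookup_nil (q : Tuple d) : lookup [] q = 0 := rfl

theorem lookup_cons (p : Tuple d × ℚ) (R : List (Tuple d × ℚ)) (q : Tuple d) :
    lookup (p :: R) q = (if p.1 = q then p.2 else 0) + lookup R q := by
  unfold lookup
  by_cases h : p.1 = q <;> simp [h]

theorem lookup_eq_sum (R : List (Tuple d × ℚ)) (q : Tuple d) :
    lookup R q = (R.map fun p => if p.1 = q then p.2 else 0).sum := by
  induction R with
  | nil => rfl
  | cons p R ih => rw [lookup_cons, ih, List.map_cons, List.sum_cons]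

theorem lookup_perm {R R' : List (Tuple d × ℚ)} (h : R.Perm R') (q : Tuple d) :
    lookup R q = lookup R' q := by
  rw [lookup_eq_sum, lookup_eq_sum]
  exact (h.map _).sum_eq

theorem lookup_eq_zero {R : List (Tuple d × ℚ)} {q : Tuple d} (h : ∀ p ∈ R, p.1 ≠ q) :
    lookup R q = 0 := by
  induction R with
  | nil => rfl
  | cons p R ih =>
    rw [List.forall_mem_cons] at h
    rw [lookup_cons, if_neg h.1, ih h.2, add_zero]

/-- Repeated tuples are harmless, since `lookup` adds their values. -/
theorem sum_map_ite_eq_sum_lookup {R : List (Tuple d × ℚ)} {K : Finset (Tuple d)}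
    (hR : ∀ p ∈ R, p.1 ∈ K) (C : Tuple d → Prop) [DecidablePred C] :
    (R.map fun p => if C p.1 then p.2 else 0).sum = ∑ z ∈ K, if C z then lookup R z else 0 := by
  induction R with
  | nil => simp [lookup_nil]
  | cons p R ih =>
    rw [List.forall_mem_cons] at hR
    rw [List.map_cons, List.sum_cons, ih hR.2]
    have : ∀ z, (if C z then lookup (p :: R) z else 0) =
        (if p.1 = z then (if C p.1 then p.2 else 0) else 0) + if C z then lookup R z else 0 := by
      intro z
      rw [lookup_cons]
      by_cases hz : p.1 = z
      · subst hz
        by_cases hC : C p.1 <;> simp [hC]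
      · simp [hz]
    simp only [this, sum_add_distrib, sum_ite_eq, hR.1, if_true]

/-! ### Products of relations -/

/-- One step of the product of a tuple with a relation. -/
def combineStep (e : Tuple d) (p : Tuple d × ℚ) (acc : List (Tuple d × ℚ)) (q : Tuple d × ℚ) :
    List (Tuple d × ℚ) :=
  if Compatible p.1 q.1 ∧ Compatible q.1 e then (union p.1 q.1, p.2 * q.2) :: acc else acc

/-- The result of `combine`. -/
def combineList (e : Tuple d) (h R : List (Tuple d × ℚ)) : List (Tuple d × ℚ) :=
  h.foldl (fun acc p => R.foldl (combineStep e p) acc) []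

/-- The old relation is kept until the product is complete, so both count towards the peak. -/
theorem combine_spec (e : Tuple d) (h R : List (Tuple d × ℚ)) {P : ℕ}
    (hP : h.length + h.length * R.length ≤ P) :
    Spec h.length (combine e h R) ((1 + 5 * R.length) * h.length) P 0
      (fun out => out = combineList e h R ∧ out.length ≤ h.length * R.length) List.length := by
  have hinner : ∀ (p : Tuple d × ℚ) (acc : List (Tuple d × ℚ)),
      h.length + (acc.length + R.length) ≤ P →
      Spec (h.length + acc.length)
        (R.foldlM (fun acc q => do
          tick 3
          if Compatible p.1 q.1 ∧ Compatible q.1 e then do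
            tick 2
            alloc 1
            pure ((union p.1 q.1, p.2 * q.2) :: acc)
          else pure acc) acc : Metered (List (Tuple d × ℚ))) (5 * R.length) P 0
        (fun out => out = R.foldl (combineStep e p) acc ∧ out.length ≤ acc.length + R.length)
        fun out => h.length + out.length := by
    intro p acc hacc
    refine Spec.mono (Spec.foldlM (o := fun out : List (Tuple d × ℚ) => h.length + out.length)
      (fun l out => l.foldl (combineStep e p) out = R.foldl (combineStep e p) acc ∧
        out.length + l.length ≤ acc.length + R.length) ?_ R acc ⟨rfl, le_rfl⟩) le_rfl le_rfl le_rfl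
      fun out hout => hout
    rintro q l out ⟨h1, h2⟩
    rw [List.foldl_cons] at h1
    rw [List.length_cons] at h2
    split_ifs with hc
    · refine Spec.tick_bind (T := 2 + 0) 3 (Spec.tick_bind 2 (Spec.alloc_bind 1 (by omega)
        (Spec.pure ⟨?_, ?_⟩ ?_)))
      · rwa [combineStep, if_pos hc] at h1
      · rw [List.length_cons]
        omega
      · rw [List.length_cons]
        omega
    · refine Spec.mono (T := 3 + 0) (Spec.tick_bind 3 (Spec.pure ⟨?_, ?_⟩ rfl)) (by omega) le_rfl
        le_rfl fun _ h => h
      · rwa [combineStep, if_neg hc] at h1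
      · omega
  have houter := Spec.foldlM (P := P) (o := fun out : List (Tuple d × ℚ) => h.length + out.length)
    (c := 1 + 5 * R.length)
    (step := fun acc p => do
      tick 1
      R.foldlM (fun acc q => do
          tick 3
          if Compatible p.1 q.1 ∧ Compatible q.1 e then do
            tick 2
            alloc 1
            pure ((union p.1 q.1, p.2 * q.2) :: acc)
          else pure acc) acc)
    (fun l out => l.foldl (fun acc p => R.foldl (combineStep e p) acc) out = combineList e h R ∧
      out.length + l.length * R.length ≤ h.length * R.length) (by
        rintro p l out ⟨h1, h2⟩
        rw [List.foldl_cons] at h1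
        rw [List.length_cons, add_mul, one_mul] at h2
        refine Spec.tick_bind 1 ((hinner p out (by omega)).mono le_rfl le_rfl le_rfl ?_)
        rintro out' ⟨rfl, h3⟩
        exact ⟨h1, by omega⟩) h [] ⟨rfl, by simp⟩
  unfold combine
  refine Spec.mono (S := 0 + 0) (T := _ + 0) (Spec.bind houter fun out hout => ?_) le_rfl le_rfl
    le_rfl fun _ h => h
  rw [add_comm]
  refine Spec.free_bind _ (Spec.pure ⟨hout.1, ?_⟩ rfl)
  simpa using hout.2

theorem lookup_foldl_combineStep (e : Tuple d) (p : Tuple d × ℚ) (R acc : List (Tuple d × ℚ))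
    (z : Tuple d) : lookup (R.foldl (combineStep e p) acc) z = lookup acc z +
      (R.map fun q => if (Compatible p.1 q.1 ∧ Compatible q.1 e) ∧ union p.1 q.1 = z then
        p.2 * q.2 else 0).sum := by
  induction R generalizing acc with
  | nil => simp
  | cons q R ih =>
    rw [List.foldl_cons, ih, List.map_cons, List.sum_cons, ← add_assoc]
    congr 1
    by_cases hc : Compatible p.1 q.1 ∧ Compatible q.1 e
    · rw [combineStep, if_pos hc, lookup_cons, add_comm]
      simp only [hc, true_and]
    · rw [combineStep, if_neg hc, if_neg (fun h => hc h.1), add_zero]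

theorem lookup_combineList (e : Tuple d) (h R : List (Tuple d × ℚ)) (z : Tuple d) :
    lookup (combineList e h R) z = (h.map fun p =>
      (R.map fun q => if (Compatible p.1 q.1 ∧ Compatible q.1 e) ∧ union p.1 q.1 = z then
        p.2 * q.2 else 0).sum).sum := by
  have : ∀ acc : List (Tuple d × ℚ),
      lookup (h.foldl (fun acc p => R.foldl (combineStep e p) acc) acc) z = lookup acc z +
      (h.map fun p => (R.map fun q => if (Compatible p.1 q.1 ∧ Compatible q.1 e) ∧
        union p.1 q.1 = z then p.2 * q.2 else 0).sum).sum := by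
    induction h with
    | nil => simp
    | cons p h ih =>
      intro acc
      rw [List.foldl_cons, ih, lookup_foldl_combineStep, List.map_cons, List.sum_cons, add_assoc]
  rw [combineList, this, lookup_nil, zero_add]

theorem mem_foldl_combineStep {e : Tuple d} {p : Tuple d × ℚ} {R acc : List (Tuple d × ℚ)}
    {x : Tuple d × ℚ} (hx : x ∈ R.foldl (combineStep e p) acc) :
    x ∈ acc ∨ ∃ q ∈ R, x.1 = union p.1 q.1 := by
  induction R generalizing acc with
  | nil => exact Or.inl hx
  | cons q R ih =>
    rw [List.foldl_cons] at hx
    rcases ih hx with hx | ⟨q', hq', hx⟩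
    · rw [combineStep] at hx
      split_ifs at hx
      · rcases List.mem_cons.1 hx with rfl | hx
        · exact Or.inr ⟨q, List.mem_cons_self, rfl⟩
        · exact Or.inl hx
      · exact Or.inl hx
    · exact Or.inr ⟨q', List.mem_cons_of_mem _ hq', hx⟩

theorem mem_combineList {e : Tuple d} {h R : List (Tuple d × ℚ)} {x : Tuple d × ℚ}
    (hx : x ∈ combineList e h R) : ∃ p ∈ h, ∃ q ∈ R, x.1 = union p.1 q.1 := by
  have : ∀ acc : List (Tuple d × ℚ), x ∈ h.foldl (fun acc p => R.foldl (combineStep e p) acc) acc →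
      x ∈ acc ∨ ∃ p ∈ h, ∃ q ∈ R, x.1 = union p.1 q.1 := by
    clear hx
    induction h with
    | nil => exact fun acc hx => Or.inl hx
    | cons p h ih =>
      intro acc hx
      rw [List.foldl_cons] at hx
      rcases ih _ hx with hx | ⟨p', hp', h'⟩
      · rcases mem_foldl_combineStep hx with hx | h'
        · exact Or.inl hx
        · exact Or.inr ⟨p, List.mem_cons_self, h'⟩
      · exact Or.inr ⟨p', List.mem_cons_of_mem _ hp', h'⟩
  simpa using this [] hx

theorem union_mem_configs {x y : Tuple d} {S S' : Finset (Fin n)} (hx : x ∈ configs d S)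
    (hy : y ∈ configs d S') : union x y ∈ configs d (S ∪ S') := by
  rw [mem_configs] at hx hy ⊢
  intro i
  rw [mem_union, ← hx, ← hy, union]
  cases x i <;> simp

/-- Checked variable by variable. A tuple over `S ∪ S'` determines both parts of the join, so only
one pair of tuples can produce it. -/
theorem compatible_and_union_eq_iff {x y : Tuple d} {S S' : Finset (Fin n)}
    (hx : x ∈ configs d S) (hy : y ∈ configs d S') (w : (i : Fin n) → Fin (d i)) :
    (Compatible x y ∧ union x y = restrict (full w) (S ∪ S')) ↔
      x = restrict (full w) S ∧ y = restrict (full w) S' := by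
  rw [mem_configs] at hx hy
  simp only [funext_iff, Compatible, ← forall_and]
  refine forall_congr' fun i => ?_
  have h1 := hx i
  have h2 := hy i
  simp only [union, restrict, full, mem_union, ← h1, ← h2]
  cases x i <;> cases y i <;> simp
  constructor
  · rintro ⟨rfl, h⟩
    exact ⟨h, h⟩
  · rintro ⟨rfl, rfl⟩
    exact ⟨rfl, rfl⟩

/-- In the double sum only the pairs of projections of `w` survive. The evidence is tested on the
tuples of `R` alone. -/
theorem lookup_combineList_restrict {e : Tuple d} {h R : List (Tuple d × ℚ)}
    {S S' : Finset (Fin n)} (hh : ∀ p ∈ h, p.1 ∈ configs d S) (hR : ∀ q ∈ R, q.1 ∈ configs d S')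
    (w : (i : Fin n) → Fin (d i)) :
    lookup (combineList e h R) (restrict (full w) (S ∪ S')) =
      lookup h (restrict (full w) S) * if Compatible (restrict (full w) S') e then
        lookup R (restrict (full w) S') else 0 := by
  rw [lookup_combineList, lookup_eq_sum h, ← List.sum_map_mul_right]
  congr 1
  refine List.map_congr_left fun p hp => ?_
  have : (if Compatible (restrict (full w) S') e then lookup R (restrict (full w) S') else 0) =
      (R.map fun q => if q.1 = restrict (full w) S' ∧ Compatible q.1 e then q.2 else 0).sum := by
    split_ifs with hc
    · rw [lookup_eq_sum]
      congr 1
      refine List.map_congr_left fun q _ => ?_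
      by_cases hq : q.1 = restrict (full w) S'
      · simp [hq, hc]
      · simp [hq]
    · symm
      apply List.sum_eq_zero
      intro a ha
      obtain ⟨q, -, rfl⟩ := List.mem_map.1 ha
      rw [if_neg]
      rintro ⟨h1, h2⟩
      exact hc (h1 ▸ h2)
  rw [this, ← List.sum_map_mul_left]
  congr 1
  refine List.map_congr_left fun q hq => ?_
  have := compatible_and_union_eq_iff (hh p hp) (hR q hq) w
  by_cases h1 : p.1 = restrict (full w) S ∧ q.1 = restrict (full w) S'
  · have h2 := this.2 h1
    rw [if_pos h1.1]
    by_cases h3 : Compatible q.1 e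
    · rw [if_pos ⟨⟨h2.1, h3⟩, h2.2⟩, if_pos ⟨h1.2, h3⟩]
    · rw [if_neg fun h => h3 h.1.2, if_neg fun h => h3 h.2, mul_zero]
  · rw [if_neg fun h => h1 (this.1 ⟨h.1.1, h.2⟩)]
    by_cases h3 : p.1 = restrict (full w) S
    · rw [if_neg (c := q.1 = _ ∧ _) fun h => h1 ⟨h3, h.1⟩, mul_zero]
    · rw [if_neg h3, zero_mul]

/-! ### Sorting -/

/-- A relation is sorted by the projections on `S`. -/
def SortedOn (S : Finset (Fin n)) (l : List (Tuple d × ℚ)) : Prop :=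
  l.Pairwise fun p q => code (restrict p.1 S) ≤ code (restrict q.1 S)

/-- A relation is sorted, and has at most one entry for every tuple. -/
def StrictSorted (l : List (Tuple d × ℚ)) : Prop :=
  l.Pairwise fun p q => code p.1 < code q.1

theorem mergeSorted_spec (S : Finset (Fin n)) (l l' : List (Tuple d × ℚ)) (a P : ℕ) :
    Spec a (mergeSorted S l l') (4 * (l.length + l'.length)) P 0
      (fun m => m.Perm (l ++ l') ∧ (SortedOn S l → SortedOn S l' → SortedOn S m)) fun _ => a := by
  induction l, l' using mergeSorted.induct with
  | case1 l =>
    rw [mergeSorted]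
    exact Spec.pure_of_eq ⟨.rfl, fun _ h => h⟩ rfl
  | case2 l hl =>
    rw [mergeSorted]
    · exact Spec.pure_of_eq ⟨by simp, fun h _ => h⟩ rfl
    · exact hl
  | case3 p l q l' ih ih' =>
    by_cases hpq : code (restrict p.1 S) ≤ code (restrict q.1 S)
    · rw [mergeSorted, if_pos hpq]
      refine Spec.mono (T := 4 + (4 * (l.length + (q :: l').length) + 0)) (S := 0 + 0)
        (Spec.tick_bind 4
        (Spec.bind ih fun m hm => Spec.pure ⟨hm.1.cons p, ?sorted⟩ rfl)) ?time le_rfl le_rfl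
        fun _ h => h
      case sorted =>
        intro h1 h2
        refine List.pairwise_cons.2 ⟨fun x hx => ?_, hm.2 (List.pairwise_cons.1 h1).2 h2⟩
        rcases List.mem_append.1 (hm.1.subset hx) with hx | hx
        · exact (List.pairwise_cons.1 h1).1 x hx
        · rcases List.mem_cons.1 hx with rfl | hx
          · exact hpq
          · exact hpq.trans ((List.pairwise_cons.1 h2).1 x hx)
      case time =>
        simp only [List.length_cons]
        omega
    · rw [mergeSorted, if_neg hpq]
      refine Spec.mono (T := 4 + (4 * ((p :: l).length + l'.length) + 0)) (S := 0 + 0)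
        (Spec.tick_bind 4
        (Spec.bind ih' fun m hm => Spec.pure ⟨?perm, ?sorted⟩ rfl)) ?time le_rfl le_rfl
        fun _ h => h
      case perm => exact (hm.1.cons q).trans List.perm_middle.symm
      case sorted =>
        intro h1 h2
        have hqp := (le_total (code (restrict p.1 S)) (code (restrict q.1 S))).resolve_left hpq
        refine List.pairwise_cons.2 ⟨fun x hx => ?_, hm.2 h1 (List.pairwise_cons.1 h2).2⟩
        rcases List.mem_append.1 (hm.1.subset hx) with hx | hx
        · rcases List.mem_cons.1 hx with rfl | hx
          · exact hqp
          · exact hqp.trans ((List.pairwise_cons.1 h1).1 x hx)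
        · exact (List.pairwise_cons.1 h2).1 x hx
      case time =>
        simp only [List.length_cons]
        omega

/-- A level of the recursion costs one operation per entry for splitting and four for merging. Both
halves have length at most `2 ^ depth` when the list has length at most `2 ^ (depth + 1)`. -/
theorem sortDepth_spec (S : Finset (Fin n)) (a P depth : ℕ) (l : List (Tuple d × ℚ)) :
    Spec a (sortDepth S depth l) (5 * l.length * depth) P 0
      (fun m => m.Perm l ∧ (l.length ≤ 2 ^ depth → SortedOn S m)) fun _ => a := by
  induction depth generalizing l with
  | zero =>
    refine Spec.pure ⟨.rfl, fun h => ?_⟩ rfl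
    rw [pow_zero] at h
    match l, h with
    | [], _ => exact List.Pairwise.nil
    | [p], _ => exact List.pairwise_singleton _ _
  | succ depth ih =>
    rw [sortDepth]
    have h1 : (l.take (l.length / 2)).length = l.length / 2 := by
      rw [List.length_take]
      omega
    have h2 : (l.drop (l.length / 2)).length = l.length - l.length / 2 := List.length_drop
    refine Spec.mono (T := l.length + (5 * (l.take (l.length / 2)).length * depth +
      (5 * (l.drop (l.length / 2)).length * depth + 4 * l.length))) (S := 0 + (0 + 0))
      (Spec.tick_bind _ (Spec.bind (ih _) fun x hx => Spec.bind (ih _) fun y hy =>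
        (mergeSorted_spec S x y a P).mono ?_ le_rfl le_rfl ?_)) ?_ le_rfl le_rfl fun _ h => h
    · rw [hx.1.length_eq, hy.1.length_eq, h1, h2]
      omega
    · rintro m ⟨hm, hs⟩
      refine ⟨hm.trans ((hx.1.append hy.1).trans (by rw [List.take_append_drop])), fun hl => ?_⟩
      rw [pow_succ] at hl
      exact hs (hx.2 (by omega)) (hy.2 (by omega))
    · rw [h1, h2]
      have h3 : l.length / 2 + (l.length - l.length / 2) = l.length := by omega
      calc _ = 5 * l.length + 5 * (l.length / 2 + (l.length - l.length / 2)) * depth := by ring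
        _ ≤ _ := by rw [h3, mul_add, mul_one, add_comm]

theorem sortOn_spec (S : Finset (Fin n)) (a P : ℕ) (l : List (Tuple d × ℚ)) :
    Spec a (sortOn S l) (l.length + 1 + 5 * l.length * Nat.clog 2 l.length) P 0
      (fun m => m.Perm l ∧ SortedOn S m) fun _ => a := by
  rw [sortOn]
  refine Spec.tick_bind _ ((sortDepth_spec S a P _ l).mono le_rfl le_rfl le_rfl fun m hm => ?_)
  exact ⟨hm.1, hm.2 (Nat.le_pow_clog one_lt_two _)⟩

/-! ### Joins -/

/-- After a match only the entry of `l` is consumed: later entries of `l` may share its projection,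
while strictness of `l'` excludes a second partner for it. An entry skipped without a match precedes
everything left in the other list. `k` counts the entries retained by the enclosing calls. -/
theorem joinSorted_spec (S : Finset (Fin n)) (l l' : List (Tuple d × ℚ)) (P : ℕ) :
    ∀ k, Spec (k + l.length) (joinSorted S l l') (5 * (l.length + l'.length)) P 0
      (fun m => m.length ≤ l.length ∧ (∀ p ∈ m, ∃ q ∈ l, p.1 = q.1) ∧
        (SortedOn S l → StrictSorted l' →
          ∀ z, lookup m z = lookup l z * lookup l' (restrict z S)))
      fun m => k + m.length := by
  induction l, l' using joinSorted.induct with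
  | case1 l =>
    intro k
    rw [joinSorted]
    exact Spec.pure_of_eq ⟨le_rfl, by simp, by simp [lookup_nil]⟩ rfl
  | case2 p l ih =>
    intro k
    rw [joinSorted]
    refine Spec.mono (T := 1 + 5 * (l.length + 0)) (Spec.tick_bind 1
      (Spec.free_bind (a := k + l.length) 1 (ih k))) ?_ le_rfl le_rfl ?_
    · simp only [List.length_cons, List.length_nil]
      omega
    · rintro m ⟨h1, h2, h3⟩
      refine ⟨h1.trans (by simp), fun x hx => ?_, fun hs hs' z => ?_⟩
      · obtain ⟨q, hq, h⟩ := h2 x hx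
        exact ⟨q, List.mem_cons_of_mem _ hq, h⟩
      · rw [h3 (List.pairwise_cons.1 hs).2 hs', lookup_nil, mul_zero, mul_zero]
  | case3 p l q l' ih ih' =>
    intro k
    by_cases hpq : restrict p.1 S = q.1
    · rw [joinSorted, if_pos hpq]
      refine Spec.mono (T := 3 + (2 + (5 * (l.length + (q :: l').length) + 0))) (S := 0 + 0)
        (Spec.tick_bind 3 (Spec.tick_bind 2 (Spec.bind (by
          rw [List.length_cons, add_comm l.length 1, ← add_assoc]
          exact ih (k + 1)) fun m hm => Spec.pure ⟨?len, ?keys, ?value⟩ ?own))) ?time le_rfl le_rfl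
        fun _ h => h
      case len => simpa using hm.1
      case keys =>
        intro x hx
        rcases List.mem_cons.1 hx with rfl | hx
        · exact ⟨p, List.mem_cons_self, rfl⟩
        · obtain ⟨y, hy, h⟩ := hm.2.1 x hx
          exact ⟨y, List.mem_cons_of_mem _ hy, h⟩
      case value =>
        intro hs hs' z
        rw [lookup_cons, hm.2.2 (List.pairwise_cons.1 hs).2 hs', lookup_cons p, add_mul]
        congr 1
        by_cases hz : p.1 = z
        · subst hz
          rw [if_pos rfl, if_pos rfl, lookup_cons, if_pos hpq.symm, lookup_eq_zero, add_zero]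
          intro y hy h
          have := (List.pairwise_cons.1 hs').1 y hy
          rw [h, hpq] at this
          exact lt_irrefl _ this
        · simp [hz]
      case own =>
        rw [List.length_cons]
        omega
      case time =>
        simp only [List.length_cons]
        omega
    by_cases hlt : code (restrict p.1 S) < code q.1
    · rw [joinSorted, if_neg hpq, if_pos hlt]
      refine Spec.mono (T := 3 + 5 * (l.length + (q :: l').length)) (Spec.tick_bind 3
        (Spec.free_bind (a := k + l.length) 1 (ih k))) ?_ le_rfl le_rfl ?_
      · simp only [List.length_cons]
        omega
      · rintro m ⟨h1, h2, h3⟩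
        refine ⟨h1.trans (by simp), fun x hx => ?_, fun hs hs' z => ?_⟩
        · obtain ⟨q, hq, h⟩ := h2 x hx
          exact ⟨q, List.mem_cons_of_mem _ hq, h⟩
        · rw [h3 (List.pairwise_cons.1 hs).2 hs', lookup_cons p, add_mul]
          by_cases hz : p.1 = z
          · subst hz
            rw [lookup_eq_zero (R := q :: l'), mul_zero, mul_zero, add_zero]
            intro y hy h
            rw [← h] at hlt
            rcases List.mem_cons.1 hy with rfl | hy
            · exact lt_irrefl _ hlt
            · exact lt_asymm hlt ((List.pairwise_cons.1 hs').1 y hy)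
          · rw [if_neg hz, zero_mul, zero_add]
    · rw [joinSorted, if_neg hpq, if_neg hlt]
      refine Spec.mono (T := 3 + 5 * ((p :: l).length + l'.length)) (Spec.tick_bind 3 (ih' k))
        ?_ le_rfl
        le_rfl ?_
      · simp only [List.length_cons]
        omega
      · rintro m ⟨h1, h2, h3⟩
        refine ⟨h1, h2, fun hs hs' z => ?_⟩
        rw [h3 hs (List.pairwise_cons.1 hs').2, lookup_cons q]
        by_cases hz : q.1 = restrict z S
        · have hqp : code q.1 < code (restrict p.1 S) :=
            lt_of_le_of_ne (not_lt.1 hlt) fun h => hpq (code_injective h).symm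
          rw [lookup_eq_zero (R := p :: l), zero_mul, zero_mul]
          intro y hy h
          rw [hz, ← h] at hqp
          rcases List.mem_cons.1 hy with rfl | hy
          · exact lt_irrefl _ hqp
          · exact not_lt_of_ge ((List.pairwise_cons.1 hs).1 y hy) hqp
        · rw [if_neg hz, zero_add]

/-! ### Summing out -/

/-- The open run `(y, a)` owns one entry beside the list, hence `l.length + 1`. In a sorted list
equal projections are consecutive, which makes the output strictly sorted. -/
theorem groupFrom_spec (S : Finset (Fin n)) (P : ℕ) (l : List (Tuple d × ℚ)) :
    ∀ k y a, Spec (k + (l.length + 1)) (groupFrom S y a l) (4 * l.length) P 0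
      (fun m => m.length ≤ l.length + 1 ∧
        (∀ p ∈ m, p.1 = y ∨ ∃ q ∈ l, p.1 = restrict q.1 S) ∧
        (SortedOn S l → (∀ q ∈ l, code y ≤ code (restrict q.1 S)) → StrictSorted m) ∧
        ∀ z, lookup m z = (if y = z then a else 0) +
          (l.map fun q => if restrict q.1 S = z then q.2 else 0).sum)
      fun m => k + m.length := by
  induction l with
  | nil =>
    intro k y a
    rw [groupFrom]
    refine Spec.pure ⟨le_rfl, by simp, fun _ _ => List.pairwise_singleton _ _, fun z => ?_⟩ rfl
    rw [lookup_cons, lookup_nil]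
    rfl
  | cons p l ih =>
    intro k y a
    rw [groupFrom]
    split_ifs with hp
    · refine Spec.mono (Spec.tick_bind 4 (Spec.free_bind 1 (ih k y (a + p.2)))) ?_ le_rfl le_rfl ?_
      · rw [List.length_cons]
        omega
      · rintro m ⟨h1, h2, h3, h4⟩
        refine ⟨h1.trans (by simp), fun x hx => ?_, fun hs hy => ?_, fun z => ?_⟩
        · rcases h2 x hx with h | ⟨q, hq, h⟩
          · exact Or.inl h
          · exact Or.inr ⟨q, List.mem_cons_of_mem _ hq, h⟩
        · exact h3 (List.pairwise_cons.1 hs).2 (List.forall_mem_cons.1 hy).2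
        · rw [h4, List.map_cons, List.sum_cons, hp, ← add_assoc]
          congr 1
          split_ifs <;> simp
    · refine Spec.mono (T := 4 + (4 * l.length + 0)) (S := 0 + 0) (Spec.tick_bind 4 (Spec.bind (by
          rw [List.length_cons, add_comm (l.length + 1) 1, ← add_assoc]
          exact ih (k + 1) (restrict p.1 S) p.2) fun m hm => Spec.pure
            ⟨?len, ?keys, ?sorted, ?value⟩ ?own)) ?time le_rfl le_rfl fun _ h => h
      case len => simpa using hm.1
      case keys =>
        intro x hx
        rcases List.mem_cons.1 hx with rfl | hx
        · exact Or.inl rfl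
        · rcases hm.2.1 x hx with h | ⟨q, hq, h⟩
          · exact Or.inr ⟨p, List.mem_cons_self, h⟩
          · exact Or.inr ⟨q, List.mem_cons_of_mem _ hq, h⟩
      case sorted =>
        intro hs hy
        have hs := List.pairwise_cons.1 hs
        rw [List.forall_mem_cons] at hy
        have hlt : code y < code (restrict p.1 S) :=
          lt_of_le_of_ne hy.1 fun h => hp (code_injective h).symm
        refine List.pairwise_cons.2 ⟨fun x hx => ?_, hm.2.2.1 hs.2 hs.1⟩
        rcases hm.2.1 x hx with h | ⟨q, hq, h⟩
        · rw [h]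
          exact hlt
        · rw [h]
          exact hlt.trans_le (hs.1 q hq)
      case value =>
        intro z
        rw [lookup_cons, hm.2.2.2, List.map_cons, List.sum_cons]
      case own =>
        rw [List.length_cons]
        omega
      case time =>
        rw [List.length_cons]
        omega

theorem sumOut_spec (S : Finset (Fin n)) (P : ℕ) (l : List (Tuple d × ℚ)) :
    Spec l.length (sumOut S l)
      (l.length + 1 + 5 * l.length * Nat.clog 2 l.length + (1 + 4 * l.length)) P 0
      (fun m => m.length ≤ l.length ∧ (∀ p ∈ m, ∃ q ∈ l, p.1 = restrict q.1 S) ∧ StrictSorted m ∧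
        ∀ z, lookup m z = (l.map fun q => if restrict q.1 S = z then q.2 else 0).sum)
      List.length := by
  rw [sumOut]
  refine Spec.bind (S := 0) (S' := 0) (sortOn_spec S l.length P l) fun h hh => Spec.tick_bind 1 ?_
  obtain ⟨hperm, hs⟩ := hh
  rw [← hperm.length_eq]
  have hsum : ∀ z, (l.map fun q => if restrict q.1 S = z then q.2 else 0).sum =
      (h.map fun q => if restrict q.1 S = z then q.2 else 0).sum :=
    fun z => (hperm.map _).sum_eq.symm
  simp only [hsum, ← hperm.mem_iff]
  cases h with
  | nil => exact Spec.pure ⟨le_rfl, by simp, List.Pairwise.nil, fun z => rfl⟩ rfl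
  | cons p h =>
    have := groupFrom_spec S P h 0 (restrict p.1 S) p.2
    simp only [zero_add] at this
    have hs := List.pairwise_cons.1 hs
    refine this.mono (by simp) le_rfl le_rfl ?_
    rintro m ⟨h1, h2, h3, h4⟩
    refine ⟨h1, fun x hx => ?_, h3 hs.2 hs.1, fun z => ?_⟩
    · rcases h2 x hx with h | ⟨q, hq, h⟩
      · exact ⟨p, List.mem_cons_self, h⟩
      · exact ⟨q, List.mem_cons_of_mem _ hq, h⟩
    · rw [h4, List.map_cons, List.sum_cons]

end Relations

/-! ### The cost and correctness of one relational message. -/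

section RelationalMessages

variable {n r : ℕ} {d : Fin n → ℕ}

theorem GraphicalModel.length_relation (M : GraphicalModel d r) (j : Fin r) :
    (M.relation j).length = M.tightness j := by
  rw [relation, List.length_map, length_toList, tightness]

theorem GraphicalModel.mem_configs_of_mem_relation (M : GraphicalModel d r) (j : Fin r)
    {p : Tuple d × ℚ} (hp : p ∈ M.relation j) : p.1 ∈ configs d (M.scope j) := by
  rw [relation, List.mem_map] at hp
  obtain ⟨x, hx, rfl⟩ := hp
  rw [mem_toList, support, mem_filter] at hx
  exact hx.1

/-- Only zeros of the function are missing from the list, and `lookup` returns `0` for them. -/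
theorem GraphicalModel.lookup_relation (M : GraphicalModel d r) (j : Fin r)
    (x : (i : Fin n) → Fin (d i)) :
    lookup (M.relation j) (restrict (full x) (M.scope j)) = M.value j (full x) := by
  rw [lookup_eq_sum, relation, List.map_map]
  simp only [Function.comp_def]
  rw [sum_map_toList, sum_ite_eq', value, support]
  simp only [mem_filter, restrict_full_mem_configs, true_and]
  split_ifs with h
  · rfl
  · exact (not_not.1 h).symm

theorem mem_foldl_union (scope : Fin r → Finset (Fin n)) (l : List (Fin r)) (S : Finset (Fin n))
    (i : Fin n) : i ∈ l.foldl (fun S j => S ∪ scope j) S ↔ i ∈ S ∨ ∃ j ∈ l, i ∈ scope j := by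
  induction l generalizing S with
  | nil => simp
  | cons j l ih =>
    rw [List.foldl_cons, ih, mem_union, or_assoc]
    simp

/-- The size bound grows by a factor `t` per function, so the costs form a geometric series; `2 ≤ t`
keeps its constant absolute. The `2` in the space bound covers an old relation together with its
successor. -/
theorem foldlM_combine_spec (M : GraphicalModel d r) (e : Tuple d) {t P : ℕ} (ht : 2 ≤ t)
    (hM : ∀ j, M.tightness j ≤ t) (l : List (Fin r)) :
    ∀ (N : ℕ) (S : Finset (Fin n)) (h : List (Tuple d × ℚ)), h.length ≤ N →
      2 * (N * t ^ l.length) ≤ P → (∀ p ∈ h, p.1 ∈ configs d S) →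
      Spec h.length (l.foldlM (fun h j => combine e h (M.relation j)) h)
        (12 * N * (t ^ l.length - 1)) P 0
        (fun out => out.length ≤ N * t ^ l.length ∧
          (∀ p ∈ out, p.1 ∈ configs d (l.foldl (fun S j => S ∪ M.scope j) S)) ∧
          ∀ w, lookup out (restrict (full w) (l.foldl (fun S j => S ∪ M.scope j) S)) =
            lookup h (restrict (full w) S) * (l.map fun j =>
              if Compatible (restrict (full w) (M.scope j)) e then M.value j (full w) else 0).prod)
        List.length := by
  induction l with
  | nil =>
    intro N S h hN _ hS
    exact Spec.pure_of_eq ⟨by simpa using hN, hS, fun w => by simp⟩ rfl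
  | cons j l ih =>
    intro N S h hN hP hS
    rw [List.foldlM_cons]
    have hR : (M.relation j).length ≤ t := M.length_relation j ▸ hM j
    -- Writing `t ^ l.length = s + 1` and `t = v + 2` removes the truncated subtractions.
    obtain ⟨s, hs⟩ : ∃ s, t ^ l.length = s + 1 :=
      Nat.exists_eq_succ_of_ne_zero (pow_pos (by omega) _).ne'
    obtain ⟨v, rfl⟩ : ∃ v, t = v + 2 := ⟨t - 2, by omega⟩
    have hmul : h.length * (M.relation j).length ≤ N * (v + 2) := Nat.mul_le_mul hN hR
    rw [List.length_cons, pow_succ, hs] at hP ⊢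
    have hP' : h.length + h.length * (M.relation j).length ≤ P := by
      have h4 : N * (v + 2) ≤ N * ((s + 1) * (v + 2)) :=
        Nat.mul_le_mul_left N (Nat.le_mul_of_pos_left _ s.succ_pos)
      have h5 : N ≤ N * (v + 2) := Nat.le_mul_of_pos_right N (v + 1).succ_pos
      omega
    have hout : ∀ out : List (Tuple d × ℚ), (out = combineList e h (M.relation j) ∧
        out.length ≤ h.length * (M.relation j).length) → _ := fun out hout =>
      ih (N * (v + 2)) (S ∪ M.scope j) out (hout.2.trans hmul) (by
        rw [hs]
        calc 2 * (N * (v + 2) * (s + 1)) = 2 * (N * ((s + 1) * (v + 2))) := by ring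
          _ ≤ P := hP) (by
        intro p hp
        rw [hout.1] at hp
        obtain ⟨x, hx, y, hy, h⟩ := mem_combineList hp
        rw [h]
        exact union_mem_configs (hS x hx) (M.mem_configs_of_mem_relation j hy))
    refine Spec.mono (S := 0 + 0) (Spec.bind (combine_spec e h _ hP') fun out h' =>
      (hout out h').mono le_rfl le_rfl le_rfl ?_) ?_ le_rfl le_rfl fun _ h => h
    · rintro m ⟨h1, h2, h3⟩
      refine ⟨?_, h2, fun w => ?_⟩
      · rw [hs] at h1
        calc m.length ≤ _ := h1
          _ = _ := by ring
      · rw [List.foldl_cons, h3, h'.1,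
          lookup_combineList_restrict hS (fun q hq => M.mem_configs_of_mem_relation j hq),
          M.lookup_relation, List.map_cons, List.prod_cons, mul_assoc]
    · have h4 : (s + 1) * (v + 2) - 1 = s * (v + 2) + (v + 1) := by
        have : (s + 1) * (v + 2) = s * (v + 2) + (v + 1) + 1 := by ring
        omega
      rw [h4, hs, Nat.add_sub_cancel]
      -- The constant `12` comes from `1 + 5 * (v + 2) ≤ 12 * (v + 1)`: one product costs at most
      -- `12 * N * (t - 1)`, and these costs telescope.
      have h5 : (1 + 5 * (M.relation j).length) * h.length ≤ (1 + 5 * (v + 2)) * N :=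
        Nat.mul_le_mul (by omega) hN
      nlinarith

/-- The messages of relational cluster-tree elimination are sorted, have no repetitions, and have at
most `H` entries. -/
def ValidMessage (H : ℕ) (sep : Finset (Fin n)) (m : List (Tuple d × ℚ)) : Prop :=
  (∀ p ∈ m, p.1 ∈ configs d sep) ∧ StrictSorted m ∧ m.length ≤ H

/-- Joining with a message only drops or reweights tuples, so the bound `H` persists. The `10 * H`
in `B` pays for scanning two lists of length at most `H` at `5` per entry. -/
theorem foldlM_join_spec {H B P : ℕ} {S : Finset (Fin n)}
    (hB : H + 1 + 5 * H * Nat.clog 2 H + 10 * H ≤ B)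
    (msgs : List (Finset (Fin n) × List (Tuple d × ℚ))) (hmsgs : ∀ m ∈ msgs, ValidMessage H m.1 m.2)
    (h : List (Tuple d × ℚ)) (hH : h.length ≤ H) (hS : ∀ p ∈ h, p.1 ∈ configs d S) :
    Spec h.length (msgs.foldlM (fun h m => do
        let h' ← sortOn m.1 h
        joinSorted m.1 h' m.2) h) (B * msgs.length) P 0
      (fun out => out.length ≤ H ∧ (∀ p ∈ out, p.1 ∈ configs d S) ∧
        ∀ z, lookup out z = lookup h z * (msgs.map fun m => lookup m.2 (restrict z m.1)).prod)
      List.length := by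
  refine Spec.mono (Spec.foldlM (o := List.length) (fun l out =>
    (∀ m ∈ l, ValidMessage H m.1 m.2) ∧ out.length ≤ H ∧ (∀ p ∈ out, p.1 ∈ configs d S) ∧
      ∀ z, lookup out z * (l.map fun m => lookup m.2 (restrict z m.1)).prod =
        lookup h z * (msgs.map fun m => lookup m.2 (restrict z m.1)).prod) ?_ msgs h
      ⟨hmsgs, hH, hS, fun z => rfl⟩) le_rfl le_rfl le_rfl ?_
  · rintro m l out ⟨h1, h2, h3, h4⟩
    rw [List.forall_mem_cons] at h1
    obtain ⟨⟨-, hm2, hm3⟩, h1⟩ := h1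
    refine Spec.mono (S := 0 + 0) (T := (out.length + 1 + 5 * out.length * Nat.clog 2 out.length) +
      5 * (out.length + m.2.length))
      (Spec.bind (sortOn_spec m.1 out.length P out) fun out' hout' => ?_) ?_ le_rfl le_rfl
      fun _ h => h
    · have := joinSorted_spec m.1 out' m.2 P 0
      simp only [zero_add] at this
      rw [hout'.1.length_eq] at this
      refine this.mono le_rfl le_rfl le_rfl ?_
      rintro x ⟨g1, g2, g3⟩
      refine ⟨h1, g1.trans h2, fun p hp => ?_, fun z => ?_⟩
      · obtain ⟨q, hq, h⟩ := g2 p hp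
        rw [h]
        exact h3 q (hout'.1.subset hq)
      · rw [← h4, g3 hout'.2 hm2, lookup_perm hout'.1, List.map_cons, List.prod_cons, mul_assoc]
    · have h5 : out.length * Nat.clog 2 out.length ≤ H * Nat.clog 2 H :=
        Nat.mul_le_mul h2 (Nat.clog_mono_right 2 h2)
      rw [mul_assoc] at hB ⊢
      omega
  · rintro out ⟨-, h2, h3, h4⟩
    exact ⟨h2, h3, fun z => by simpa using h4 z⟩

/-- Covering is essential: evidence on a variable of the cluster is tested only through some
function of the cluster whose scope contains it. -/
theorem clusterFunc_eq_prod (M : GraphicalModel d r) (τ : TreeDecomposition M.scope) (e : Tuple d)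
    {u : Fin τ.size} (hu : τ.χ u ⊆ (τ.ψ u).biUnion M.scope) (w : (i : Fin n) → Fin (d i)) :
    clusterFunc M τ e u (restrict (full w) (τ.χ u)) = ((τ.ψ u).toList.map fun j =>
      if Compatible (restrict (full w) (M.scope j)) e then M.value j (full w) else 0).prod := by
  rw [prod_map_toList, clusterFunc]
  split_ifs with h
  · refine prod_congr rfl fun j hj => ?_
    rw [M.value_restrict (τ.scope_subset u j hj), if_pos]
    intro i
    by_cases hi : i ∈ M.scope j
    · have := h i
      simp only [restrict, τ.scope_subset u j hj hi, if_true] at this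
      simpa only [restrict, hi, if_true] using this
    · simp [restrict, hi]
  · unfold Compatible at h
    push Not at h
    obtain ⟨i, hi1, hi2, hi3⟩ := h
    have hi : i ∈ τ.χ u := by
      by_contra hi
      simp [restrict, hi] at hi1
    obtain ⟨j, hj, hij⟩ := mem_biUnion.1 (hu hi)
    refine (prod_eq_zero hj (if_neg fun hc => ?_)).symm
    have := hc i
    simp only [restrict, hij, hi, if_true] at this hi1 hi3
    tauto

/-- `12 * H` pays for combining the functions, one `B` for each message, and one more `B` for
summing out. -/
theorem sendRelation_spec (M : GraphicalModel d r) (τ : TreeDecomposition M.scope) (e : Tuple d)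
    {t H B : ℕ} (ht : 2 ≤ t) (hM : ∀ j, M.tightness j ≤ t)
    (hB : H + 1 + 5 * H * Nat.clog 2 H + 10 * H ≤ B)
    (u : Fin τ.size) (hu : τ.χ u ⊆ (τ.ψ u).biUnion M.scope) (hH : t ^ #(τ.ψ u) ≤ H)
    (sep : Finset (Fin n)) (hsep : sep ⊆ τ.χ u)
    (msgs : List (Finset (Fin n) × List (Tuple d × ℚ)))
    (hmsgs : ∀ m ∈ msgs, m.1 ⊆ τ.χ u ∧ ValidMessage H m.1 m.2) :
    Spec 0 (sendRelation M τ e u sep msgs) (12 * H + B + B * msgs.length) (2 * H) H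
      (fun out => ValidMessage H sep out ∧ (fun x => lookup out (restrict (full x) sep)) =
        marg (τ.χ u \ sep)
          (factor M τ e u * (msgs.map fun m x => lookup m.2 (restrict (full x) m.1)).prod))
      fun _ => 0 := by
  have hpos : 0 < t ^ #(τ.ψ u) := pow_pos (by omega) _
  -- The product starts from the constant `1` on the empty scope, a single entry, hence `N = 1`.
  have hcombine := foldlM_combine_spec M e ht hM (P := 2 * H) (τ.ψ u).toList 1 ∅
    [((fun _ => none : Tuple d), (1 : ℚ))] le_rfl (by rw [length_toList]; omega)
    (by simp [mem_configs])
  have hfold : (τ.ψ u).toList.foldl (fun S j => S ∪ M.scope j) ∅ = τ.χ u := by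
    ext i
    rw [mem_foldl_union]
    simp only [notMem_empty, mem_toList, false_or]
    exact ⟨fun ⟨j, hj, hi⟩ => τ.scope_subset u j hj hi, fun hi => mem_biUnion.1 (hu hi)⟩
  rw [hfold, length_toList] at hcombine
  unfold sendRelation
  refine Spec.alloc_bind 1 (by omega) ?_
  refine Spec.mono (T := 12 * H + (B * msgs.length + (B + 0))) (S := 0 + (0 + (0 + H)))
    (Spec.bind (b := List.length) (hcombine.mono ?_ le_rfl le_rfl fun _ h => h) fun h hh =>
      Spec.bind (foldlM_join_spec (S := τ.χ u) hB msgs (fun m hm => (hmsgs m hm).2) h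
        (hh.1.trans (by omega)) hh.2.1) fun h' hh' =>
        Spec.bind ((sumOut_spec sep _ h').mono ?_ le_rfl le_rfl fun _ h => h) fun out hout => ?_)
    (by omega) le_rfl (by omega) fun _ h => h
  · omega
  · have h5 : h'.length * Nat.clog 2 h'.length ≤ H * Nat.clog 2 H :=
      Nat.mul_le_mul hh'.1 (Nat.clog_mono_right 2 hh'.1)
    have h6 := hh'.1
    rw [mul_assoc] at hB ⊢
    omega
  · obtain ⟨h1, h2, h3, h4⟩ := hout
    have hlen : out.length ≤ H := h1.trans hh'.1
    refine Spec.emit_pure ?_ rfl hlen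
    refine ⟨⟨fun p hp => ?_, h3, hlen⟩, ?_⟩
    · obtain ⟨q, hq, h⟩ := h2 p hp
      rw [h]
      exact restrict_mem_configs (hh'.2.1 q hq) hsep
    · funext x
      rw [h4, sum_map_ite_eq_sum_lookup hh'.2.1 fun z => restrict z sep = restrict (full x) sep,
        marg_factor_mul M τ e u lookup hsep fun m hm => (hmsgs m hm).1]
      refine sum_congr rfl fun z hz => ?_
      -- The lookup formula concerns projections of full assignments; how `z` is completed outside
      -- the cluster is immaterial.
      have hz' := restrict_full_complete hz x
      have h8 := hh.2.2 (complete z x)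
      rw [← clusterFunc_eq_prod M τ e hu, hz'] at h8
      have h9 : (fun _ => none : Tuple d) = restrict (full (complete z x)) ∅ := by
        funext i
        simp [restrict]
      have h10 : lookup [((fun _ => none : Tuple d), (1 : ℚ))]
          (restrict (full (complete z x)) ∅) = 1 := by
        rw [lookup_cons, lookup_nil, add_zero]
        exact if_pos h9
      rw [hh'.2.2, h8, h10, one_mul]

end RelationalMessages

/-! ### Total cost of both algorithms. -/

section Elimination

variable {n r : ℕ} {d : Fin n → ℕ}

theorem cells_le {k : ℕ} (hd : ∀ i, d i ≤ k) (S : Finset (Fin n)) : cells d S ≤ k ^ #S :=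
  prod_le_pow_card _ _ _ fun i _ => hd i

/-- Irredundancy is used twice: for at most `n` clusters, and for separators that are proper subsets
of clusters and so have at most `w` variables. -/
theorem cteTable_spec (M : GraphicalModel d r) (τ : TreeDecomposition M.scope) (e : Tuple d)
    {Q : Finset (Fin n)} {root : Fin τ.size} (hQ : Q ⊆ τ.χ root) {k w : ℕ} (hw : τ.width = w)
    (hn : 0 < n)
    (hd : ∀ i, 1 ≤ d i ∧ d i ≤ k) (hcover : ∀ i, ∃ j, i ∈ M.scope j)
    (hred : ∀ u v, τ.tree.Adj u v → ¬ τ.χ u ⊆ τ.χ v) :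
    Spec 0 (cteTable M τ e Q root) ((10 * n + 2 * r) * k ^ (w + 1))
      (k ^ max w #Q) (n * k ^ max w #Q)
      (fun b => ∀ q ∈ configs d Q, b q = M.sumProduct e q) fun _ => 0 := by
  subst hw
  have hk : 1 ≤ k := (hd ⟨0, hn⟩).1.trans (hd ⟨0, hn⟩).2
  have hK : 1 ≤ k ^ (τ.width + 1) := Nat.one_le_pow _ _ hk
  have hχ : ∀ u, #(τ.χ u) ≤ τ.width + 1 := by
    intro u
    have := le_sup (f := fun v => #(τ.χ v)) (mem_univ u)
    unfold TreeDecomposition.width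
    omega
  have hcells : ∀ u, ∀ S ⊆ τ.χ u, cells d S ≤ k ^ (τ.width + 1) := fun u S hS =>
    (cells_le (fun i => (hd i).2) S).trans (Nat.pow_le_pow_right hk ((card_le_card hS).trans (hχ u)))
  have hgood : ∀ S : Finset (Fin n), #S ≤ max τ.width #Q → cells d S ≤ k ^ max τ.width #Q :=
    fun S hS => (cells_le (fun i => (hd i).2) S).trans (Nat.pow_le_pow_right hk hS)
  have hsize : τ.size ≤ n := by
    obtain ⟨j, hj⟩ := hcover ⟨0, hn⟩
    obtain ⟨v, hv, -⟩ := τ.existsUnique_mem j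
    exact τ.size_le_of_reduced hred v ⟨_, τ.scope_subset v j hv hj⟩
  have hcard : #(side τ.tree none root) = τ.size := by
    rw [side_none τ.isTree.connected, card_univ, Fintype.card_fin]
  have := collect_spec (d := d) τ (send := sendTable M τ e) (Valid := fun _ _ => True)
    (read := fun sep b x => b (restrict (full x) sep)) (g := factor M τ e)
    (Good := fun S => cells d S ≤ k ^ max τ.width #Q)
    (A := fun u => (6 + 2 * #(τ.ψ u)) * k ^ (τ.width + 1)) (B := 3 * k ^ (τ.width + 1))
    (P := k ^ max τ.width #Q) (S := k ^ max τ.width #Q) (dependsOn_factor M τ e) ?good ?send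
    τ.size none root Q (by simp) hQ (hgood _ (le_max_right _ _)) hcard.le
  case good =>
    intro u c huc
    refine hgood _ (le_trans ?_ (le_max_left _ _))
    have h1 : #(τ.χ u ∩ τ.χ c) < #(τ.χ u) := by
      refine card_lt_card ⟨inter_subset_left, fun h => hred u c huc ?_⟩
      exact h.trans inter_subset_right
    have := hχ u
    omega
  case send =>
    intro u sep msgs hsep hs hmsgs
    refine (sendTable_spec M τ e u sep msgs hsep fun m hm => (hmsgs m hm).1).mono ?_ hs hs
      fun b hb => ⟨trivial, hb⟩
    have h1 := hcells u sep hsep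
    have h2 := Nat.mul_le_mul_left (5 + 2 * #(τ.ψ u) + 3 * msgs.length) (hcells u _ subset_rfl)
    nlinarith
  refine this.mono ?_ le_rfl ?_ ?_
  · rw [side_none τ.isTree.connected]
    refine (Nat.sub_le _ _).trans ?_
    -- Per cluster `6 + 3` units of `k ^ (w + 1)`, and the `1` of the recursion, make `10 * n`. The
    -- functions are counted once over the whole tree, giving `2 * r`.
    rw [sum_add_distrib, sum_add_distrib, ← sum_mul, sum_add_distrib, ← mul_sum, τ.sum_card]
    simp only [sum_const, card_univ, Fintype.card_fin, smul_eq_mul]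
    nlinarith
  · rw [hcard, mul_comm]
    exact Nat.mul_le_mul_right _ hsize
  · rintro b ⟨-, hb⟩ q hq
    -- The value `0`, present in every nonempty domain, completes `q` to a full assignment.
    have hq' := restrict_full_complete hq fun i => ⟨0, (hd i).1⟩
    have := congrFun hb (complete q fun i => ⟨0, (hd i).1⟩)
    rw [marg_prod_factor M τ e hcover] at this
    simpa only [hq'] using this

theorem cteRelation_spec (M : GraphicalModel d r) (τ : TreeDecomposition M.scope) (e : Tuple d)
    {Q : Finset (Fin n)} {root : Fin τ.size} (hQ : Q ⊆ τ.χ root) {t hw : ℕ}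
    (hhw : τ.hyperwidth = hw) (ht : 2 ≤ t)
    (hd : ∀ i, 1 ≤ d i) (hM : ∀ j, M.tightness j ≤ t) (hcover : ∀ i, ∃ j, i ∈ M.scope j)
    (hτ : τ.IsHypertree) (hψ : ∀ u, (τ.ψ u).Nonempty) :
    Spec 0 (cteRelation M τ e Q root)
      (r * (47 * (t ^ hw * (hw * Nat.clog 2 t))))
      (2 * t ^ hw) (r * t ^ hw)
      (fun b => ∀ q ∈ configs d Q, lookup b q = M.sumProduct e q) fun _ => 0 := by
  subst hhw
  set H := t ^ τ.hyperwidth with hH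
  set L := τ.hyperwidth * Nat.clog 2 t with hL
  have hψ' : ∀ u, #(τ.ψ u) ≤ τ.hyperwidth := fun u => le_sup (f := fun v => #(τ.ψ v)) (mem_univ u)
  have hH1 : 1 ≤ H := Nat.one_le_pow _ _ (by omega)
  -- Lower-order terms are absorbed into `H * L`, which needs `L ≠ 0`.
  have hL1 : 1 ≤ L :=
    Nat.mul_pos ((hψ root).card_pos.trans_le (hψ' root)) (Nat.clog_pos one_lt_two ht)
  -- Raise `t ≤ 2 ^ Nat.clog 2 t` to the power of the hypertree width.
  have hclog : Nat.clog 2 H ≤ L := by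
    refine Nat.clog_le_of_le_pow ?_
    rw [hH, hL, mul_comm, pow_mul]
    exact Nat.pow_le_pow_left (Nat.le_pow_clog one_lt_two t) _
  have hsize : τ.size ≤ r := τ.size_le_of_nonempty hψ
  have hcard : #(side τ.tree none root) = τ.size := by
    rw [side_none τ.isTree.connected, card_univ, Fintype.card_fin]
  have hHL := Nat.mul_le_mul_left H hclog
  have hHL1 := Nat.mul_le_mul_left H hL1
  have := collect_spec (d := d) τ (send := sendRelation M τ e) (Valid := ValidMessage H)
    (read := fun sep b x => lookup b (restrict (full x) sep)) (g := factor M τ e)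
    (Good := fun _ => True)
    (A := fun _ => 12 * H + (H + 1 + 5 * H * Nat.clog 2 H + 10 * H))
    (B := H + 1 + 5 * H * Nat.clog 2 H + 10 * H)
    (P := 2 * H) (S := H) (dependsOn_factor M τ e) (fun _ _ _ => trivial)
    (fun u sep msgs hsep _ hmsgs => sendRelation_spec M τ e ht hM le_rfl u (hτ u)
      (Nat.pow_le_pow_right (by omega) (hψ' u)) sep hsep msgs hmsgs)
    τ.size none root Q (by simp) hQ trivial hcard.le
  refine this.mono ?_ le_rfl ?_ ?_
  · refine (Nat.sub_le _ _).trans ?_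
    rw [sum_const, hcard, smul_eq_mul]
    refine Nat.mul_le_mul hsize ?_
    -- A cluster costs at most `34 * H + 10 * (H * Nat.clog 2 H) + 3`, and `34 + 10 + 3 = 47`.
    rw [mul_assoc 5]
    omega
  · rw [hcard, mul_comm]
    exact Nat.mul_le_mul_right _ hsize
  · rintro b ⟨-, hb⟩ q hq
    have hq' := restrict_full_complete hq fun i => ⟨0, hd i⟩
    have := congrFun hb (complete q fun i => ⟨0, hd i⟩)
    rw [marg_prod_factor M τ e hcover] at this
    simpa only [hq'] using this

end Elimination

/-! ### Sparsity of empirical tables and the change of logarithm. -/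

section EmpiricalNetworks

variable {n t : ℕ} {d : Fin n → ℕ}

/-- An empirical conditional probability table has at most one nonzero entry for every sample. -/
theorem tightness_empBN_le (G : Digraph (Fin n)) (D : Fin t → (i : Fin n) → Fin (d i)) (i : Fin n) :
    (empBN G D).tightness i ≤ t := by
  have hsub : (empBN G D).support i ⊆
      univ.image fun a => restrict (full (D a)) (family G i) := by
    intro x hx
    rw [GraphicalModel.support, mem_filter] at hx
    obtain ⟨hx, hne⟩ := hx
    have hx : x ∈ configs d (family G i) := hx
    have hne : (count D (restrict x (family G i)) : ℚ) /
        count D (restrict x (parents G i)) ≠ 0 := hne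
    -- A nonzero quotient has a nonzero numerator, so `x` is the projection of some sample.
    have h1 : count D (restrict x (family G i)) ≠ 0 := by
      intro h
      simp [h] at hne
    obtain ⟨a, ha⟩ := card_ne_zero.1 h1
    rw [mem_filter_univ] at ha
    refine mem_image.2 ⟨a, mem_univ _, ?_⟩
    rw [← restrict_full_complete hx (D a), restrict_restrict subset_rfl,
      compatible_full_restrict_iff] at ha
    rw [← restrict_full_complete hx (D a), restrict_full_eq_iff]
    exact ha
  calc (empBN G D).tightness i ≤ _ := card_le_card hsub
    _ ≤ _ := card_image_le
    _ = t := by rw [card_univ, Fintype.card_fin]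

/-- Rounding up at most doubles the rounded-down binary logarithm, and `2 / log 2 < 3`. -/
theorem clog_two_le {t : ℕ} (ht : 2 ≤ t) : (Nat.clog 2 t : ℝ) ≤ 3 * Real.log t := by
  have h1 : Nat.clog 2 t ≤ Nat.log 2 t + 1 := Nat.clog_le_of_le_pow
    (Nat.lt_pow_succ_log_self one_lt_two t).le
  have h2 : 1 ≤ Nat.log 2 t := Nat.log_pos one_lt_two ht
  have h3 : (Nat.clog 2 t : ℝ) ≤ 2 * Nat.log 2 t := by
    exact_mod_cast (by omega : Nat.clog 2 t ≤ 2 * Nat.log 2 t)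
  have h4 : (Nat.log 2 t : ℝ) * Real.log 2 ≤ Real.log t := by
    rw [← Real.log_pow]
    refine Real.log_le_log (by positivity) ?_
    exact_mod_cast Nat.pow_log_le_self 2 (by omega)
  have h5 := Real.log_two_gt_d9
  have h6 : (0 : ℝ) ≤ Nat.log 2 t := Nat.cast_nonneg _
  nlinarith

end EmpiricalNetworks

end EmpBN

/-! ### Assembly of the bounds. -/

theorem mainTheorem1 :
    ∃ C : ℝ, 0 < C ∧ ∀ (n : ℕ), 0 < n → ∀ (G : Digraph (Fin n)), EmpBN.IsAcyclic G →
      -- every empirical table has at most `t` nonzero entries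
      (∀ (d : Fin n → ℕ) (t : ℕ) (D : Fin t → (i : Fin n) → Fin (d i)) (i : Fin n),
        (EmpBN.empBN G D).tightness i ≤ t) ∧
      -- the bounds in terms of the treewidth
      (∃ τ : EmpBN.TreeDecomposition (EmpBN.family G),
        τ.width = EmpBN.treewidth (EmpBN.family G) ∧
        ∀ (k : ℕ) (d : Fin n → ℕ), (∀ i, 1 ≤ d i ∧ d i ≤ k) →
        ∀ (t : ℕ) (D : Fin t → (i : Fin n) → Fin (d i))
          (e : EmpBN.Tuple d) (Q : Finset (Fin n)) (root : Fin τ.size), Q ⊆ τ.χ root →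
          let run := EmpBN.runMetered (EmpBN.cteTable (EmpBN.empBN G D) τ e Q root)
          let w := EmpBN.treewidth (EmpBN.family G)
          (∀ q ∈ EmpBN.configs d Q, run.1 q = (EmpBN.empBN G D).sumProduct e q) ∧
          (run.2.time : ℝ) ≤ C * (n * (k : ℝ) ^ (w + 1)) ∧
          (run.2.peak : ℝ) ≤ C * (k : ℝ) ^ max w Q.card ∧
          (run.2.sent : ℝ) ≤ C * (n * (k : ℝ) ^ max w Q.card)) ∧
      -- the bounds in terms of the hypertree width
      (∃ τ : EmpBN.TreeDecomposition (EmpBN.family G),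
        τ.IsHypertree ∧ τ.hyperwidth = EmpBN.hypertreewidth (EmpBN.family G) ∧
        ∀ (d : Fin n → ℕ) (t : ℕ), 2 ≤ t → ∀ (D : Fin t → (i : Fin n) → Fin (d i))
          (e : EmpBN.Tuple d) (Q : Finset (Fin n)) (root : Fin τ.size), Q ⊆ τ.χ root →
          let run := EmpBN.runMetered (EmpBN.cteRelation (EmpBN.empBN G D) τ e Q root)
          let hw := EmpBN.hypertreewidth (EmpBN.family G)
          (∀ q ∈ EmpBN.configs d Q,
            EmpBN.lookup run.1 q = (EmpBN.empBN G D).sumProduct e q) ∧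
          (run.2.time : ℝ) ≤ C * (n * hw * Real.log t * (t : ℝ) ^ hw) ∧
          (run.2.peak : ℝ) ≤ C * (t : ℝ) ^ hw ∧
          (run.2.sent : ℝ) ≤ C * (n * (t : ℝ) ^ hw)) := by
  -- `141 = 47 * 3`: the constant of relational elimination times the change of logarithm. All other
  -- constants are smaller.
  refine ⟨141, by norm_num, fun n hn G _ => ⟨fun d t D i => EmpBN.tightness_empBN_le G D i, ?_, ?_⟩⟩
  all_goals have hcover : ∀ i, ∃ j, i ∈ EmpBN.family G j :=
    fun i => ⟨i, Finset.mem_insert_self _ _⟩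
  · obtain ⟨τ, hw, hred⟩ := EmpBN.exists_reduced_treeDecomposition (EmpBN.family G) hcover
    refine ⟨τ, hw, fun k d hd t D e Q root hQ => ?_⟩
    obtain ⟨h1, -, h2, h3, h4⟩ := EmpBN.cteTable_spec (EmpBN.empBN G D) τ e hQ hw hn hd hcover hred
      -- An empty frame and the meter from which `runMetered` starts.
      0 ⟨0, 0, 0, 0⟩ rfl
    simp only [zero_add, zero_le, max_eq_right] at h2 h3 h4
    intro run w
    refine ⟨h1, ?_, ?_, ?_⟩
    · calc (run.2.time : ℝ) ≤ ((10 * n + 2 * n) * k ^ (w + 1) : ℕ) := Nat.cast_le.2 h2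
        _ = 12 * (n * (k : ℝ) ^ (w + 1)) := by push_cast; ring
        _ ≤ 141 * (n * (k : ℝ) ^ (w + 1)) := by gcongr; norm_num
    · calc (run.2.peak : ℝ) ≤ (k ^ max w Q.card : ℕ) := Nat.cast_le.2 h3
        _ = 1 * (k : ℝ) ^ max w Q.card := by push_cast; ring
        _ ≤ 141 * (k : ℝ) ^ max w Q.card := by gcongr; norm_num
    · calc (run.2.sent : ℝ) ≤ (n * k ^ max w Q.card : ℕ) := Nat.cast_le.2 h4
        _ = 1 * (n * (k : ℝ) ^ max w Q.card) := by push_cast; ring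
        _ ≤ 141 * (n * (k : ℝ) ^ max w Q.card) := by gcongr; norm_num
  · obtain ⟨τ, hτ, hw, hψ⟩ :=
      EmpBN.exists_reduced_hypertreeDecomposition (EmpBN.family G) hcover hn
    refine ⟨τ, hτ, hw, fun d t ht D e Q root hQ => ?_⟩
    obtain ⟨h1, -, h2, h3, h4⟩ := EmpBN.cteRelation_spec (EmpBN.empBN G D) τ e hQ hw ht
      -- Since `2 ≤ t` there is a sample, so no domain is empty.
      (fun i => (D ⟨0, by omega⟩ i).pos) (EmpBN.tightness_empBN_le G D) hcover hτ hψ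
      0 ⟨0, 0, 0, 0⟩ rfl
    simp only [zero_add, zero_le, max_eq_right] at h2 h3 h4
    intro run hw
    have hlog := EmpBN.clog_two_le ht
    refine ⟨h1, ?_, ?_, ?_⟩
    · calc (run.2.time : ℝ) ≤ (n * (47 * (t ^ hw * (hw * Nat.clog 2 t))) : ℕ) := Nat.cast_le.2 h2
        _ = 47 * (n * hw * (Nat.clog 2 t : ℝ) * (t : ℝ) ^ hw) := by push_cast; ring
        _ ≤ 47 * (n * hw * (3 * Real.log t) * (t : ℝ) ^ hw) := by gcongr
        _ = 141 * (n * hw * Real.log t * (t : ℝ) ^ hw) := by ring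
    · calc (run.2.peak : ℝ) ≤ (2 * t ^ hw : ℕ) := Nat.cast_le.2 h3
        _ = 2 * (t : ℝ) ^ hw := by push_cast; ring
        _ ≤ 141 * (t : ℝ) ^ hw := by gcongr; norm_num
    · calc (run.2.sent : ℝ) ≤ (n * t ^ hw : ℕ) := Nat.cast_le.2 h4
        _ = 1 * (n * (t : ℝ) ^ hw) := by push_cast; ring
        _ ≤ 141 * (n * (t : ℝ) ^ hw) := by gcongr; norm_num
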